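/- Let $m\ge 2$ and let $p_1,\dots,p_m>0$ with $p_1+\dots+p_m=1$. Consider independent infinite random strings over the alphabet $\{a_1,\dots,a_m\}$, whose letters are independent and equal $a_j$ with probability $p_j$. The $m$-ary trie on $n$ distinct strings is defined recursively: it is empty for $n=0$, it is a single external node for $n=1$, and for $n\ge 2$ it is an internal (root) node with $m$ ordered subtrees, the $j$-th of which is the trie on those strings that begin with $a_j$, with this first letter removed. Let $T$ be a fixed motif (trie shape) of size $\tau\ge 2$, the size being the number of its external nodes, and let $X_{n,T}$ be the number of occurrences of $T$ on the fringe of the trie on $n$ random strings, i.e. the number of nodes of the trie such that the entire subtree rooted there has shape $T$. Let $\mathcal Q(T)$ be the probability that the trie on $\tau$ random strings has shape $T$ (the shape functional), and let $h=-\sum_{j=1}^m p_j\ln p_j$. Call the probabilities periodic if $\ln p_j/\ln p_k$ is rational for all $j,k$, and aperiodic otherwise. Then $X_{n,T}$ is integrable for every $n$, and there is a function $\xi_T:\mathbb R\to\mathbb R$, depending only on $T$ and $p_1,\dots,p_m$, such that, as $n\to\infty$, $$\mathbb E[X_{n,T}]=\frac{\mathcal Q(T)}{\tau(\tau-1)h}\,n+\xi_T(n)\,n+o(n).$$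 In the periodic case the numbers $\ln p_1,\dots,\ln p_m$ generate the group $d\,\mathbb Z$ for some $d>0$, and $\xi_T$ is, on $(0,\infty)$, a continuous function such that $t\mapsto \xi_T(e^t)$ is periodic with period $d$ and has average value zero, i.e. $\frac1d\int_0^d\xi_T(e^t)\,dt=0$. In the aperiodic case $\xi_T=0$ identically. -/

import Mathlib

noncomputable section

namespace RandomTrie

open MeasureTheory

/-- Shapes of `m`-ary tries: the empty tree, a single external node, or an internal node with `m`
ordered subtrees, one for each letter of the alphabet `Fin m`. -/
inductive Shape (m : ℕ) : Type
  | empty : Shape m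
  | leaf : Shape m
  | node (c : Fin m → Shape m) : Shape m

/-- The size of a shape: its number of (nonempty) external nodes. -/
def Shape.size {m : ℕ} : Shape m → ℕ
  | .empty => 0
  | .leaf => 1
  | .node c => ∑ a, (c a).size

/-- The recursive definition of a trie. `HasShape ω T I l` says that the trie built from the
strings `ω i`, `i ∈ I`, by branching on the letters at positions `l, l + 1, …` (positions are
counted from `0`) has shape `T`. No strings give the empty trie, one string gives an external node,
and two or more strings give an internal node whose `a`-th subtree is the trie on the strings with
letter `a` at position `l`. -/
def HasShape {m : ℕ} (ω : ℕ → ℕ → Fin m) : Shape m → Finset ℕ → ℕ → Prop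
  | .empty, I, _ => I.card = 0
  | .leaf, I, _ => I.card = 1
  | .node c, I, l => 2 ≤ I.card ∧ ∀ a, HasShape ω (c a) (I.filter fun i => ω i l = a) (l + 1)

/-- The indices `i < n` of the strings `ω i` that have the word `w` as a prefix. -/
def withPrefix {m : ℕ} (ω : ℕ → ℕ → Fin m) (n : ℕ) (w : List (Fin m)) : Finset ℕ :=
  (Finset.range n).filter fun i => ∀ k : Fin w.length, ω i k = w.get k

/-- The number of occurrences of a motif `T` with at least two external nodes on the fringe of the
trie built from the first `n` strings: the number of nodes at which the whole subtree hanging there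
has shape `T`. A node is identified with the word `w` spelled out on the path from the root to it,
and the subtree at `w` is the trie on the strings with prefix `w`, branching from position `|w|`
on; a word `w` at which `T` occurs is then a prefix of two or more strings, hence an internal
node of the trie. -/
def fringeCount {m : ℕ} (n : ℕ) (T : Shape m) (ω : ℕ → ℕ → Fin m) : ℕ :=
  Set.ncard {w : List (Fin m) | HasShape ω T (withPrefix ω n w) w.length}

/-- The law of one letter: letter `a` has probability `p a`. -/
def letterLaw {m : ℕ} (p : Fin m → ℝ) : Measure (Fin m) :=
  ∑ a, ENNReal.ofReal (p a) • Measure.dirac a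

/-- The law of an infinite sequence of independent strings from the memoryless source `p`: the
letter at position `k` of the string `i` is `ω i k`, and all these letters are independent with law
`letterLaw p`. -/
def stringsLaw {m : ℕ} (p : Fin m → ℝ) : Measure (ℕ → ℕ → Fin m) :=
  Measure.infinitePi fun _ : ℕ => Measure.infinitePi fun _ : ℕ => letterLaw p

/-- The shape functional: the probability that the trie on `τ` random strings, `τ` the size of
`T`, has shape `T`. -/
def shapeFunctional {m : ℕ} (p : Fin m → ℝ) (T : Shape m) : ℝ :=
  (stringsLaw p).real {ω | HasShape ω T (Finset.range T.size) 0}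

/-- The entropy of the source. -/
def entropy {m : ℕ} (p : Fin m → ℝ) : ℝ :=
  -∑ j, p j * Real.log (p j)

/-- The probabilities are periodic if all the ratios `log p_j / log p_k` are rational. -/
def IsPeriodic {m : ℕ} (p : Fin m → ℝ) : Prop :=
  ∀ j k, ∃ q : ℚ, Real.log (p j) / Real.log (p k) = q

/-- A fluctuating function on `(0, ∞)` of logarithmic period `d` with average value zero:
`ξ x` is a continuous `d`-periodic function of `log x` whose mean over a period is zero. -/
structure IsFluctuation (d : ℝ) (ξ : ℝ → ℝ) : Prop where
  continuousOn : ContinuousOn ξ (Set.Ioi 0)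
  periodic : Function.Periodic (fun t => ξ (Real.exp t)) d
  mean_zero : (1 / d) * ∫ t in (0 : ℝ)..d, ξ (Real.exp t) = 0

end RandomTrie

end

noncomputable section

namespace RandomTrie

open MeasureTheory ProbabilityTheory Filter Topology
open scoped ENNReal Asymptotics

variable {m : ℕ} {p : Fin m → ℝ}

/-! Write P(w) for the probability of a prefix w. The motif T occurs at the node w exactly when τ of
the n strings start with w and their tails form a trie of shape T. These two conditions involve
disjoint sets of letters, so the probability is Q(T) times the binomial weight C(n,τ) P(w)^τ (1 -
P(w))^(n-τ) (`stringsLaw_hasShape_withPrefix`). By linearity E[X] is Q(T) times the sum of these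
weights over all words.

The binomial weight is then replaced by the Poisson weight at nP(w). The error is at most ε_n times
`envelope` at nP(w), with ε_n → 0 (`exists_binomial_sub_poissonWeight_le`), and the envelopes sum to
O(n) (`exists_envelope_bound`), so the total error is o(n). No contour integrals or Mellin
transforms are needed.

Let G(t) be the Poisson sum at x = e^t divided by x (`renewalMean`), and let φ be the term of the
empty word. Splitting off the first letter gives the renewal equation G(t) = φ(t) + ∑ p_j G(t + ln
p_j), whose steps -ln p_j have mean h. A Choquet–Deny type argument shows that a bounded
asymptotically harmonic function is asymptotically invariant under the steps
(`tendsto_sub_translate`), hence under the group they generate. Averaging G over one step gives a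
quantity that the renewal equation computes exactly: the integral of φ up to t, or the sum of φ over
t - nd. Asymptotic invariance identifies it with hG(t), up to the factor d in the lattice case. If
the group is dense, G tends to ∫φ / h = 1/(τ(τ-1)h) (`renewal_nonlattice`); if it is dℤ, G
approaches d/h times the d-periodization of φ (`renewal_lattice`), whose mean is the same constant.
-/

/-- The probability that a random string starts with the word `w`. -/
def wordProb (p : Fin m → ℝ) (w : List (Fin m)) : ℝ := (w.map p).prod

@[simp] lemma wordProb_nil : wordProb p [] = 1 := rfl

@[simp] lemma wordProb_cons (a : Fin m) (w : List (Fin m)) :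
    wordProb p (a :: w) = p a * wordProb p w := by
  simp [wordProb]

lemma wordProb_pos (hp : ∀ j, 0 < p j) (w : List (Fin m)) : 0 < wordProb p w := by
  induction w with
  | nil => simp
  | cons a w ih => rw [wordProb_cons]; exact mul_pos (hp a) ih

lemma letter_le_one (hp : ∀ j, 0 < p j) (hp1 : ∑ j, p j = 1) (a : Fin m) : p a ≤ 1 := by
  rw [← hp1]
  exact Finset.single_le_sum (fun j _ => (hp j).le) (Finset.mem_univ a)

lemma wordProb_le_one (hp : ∀ j, 0 < p j) (hp1 : ∑ j, p j = 1) (w : List (Fin m)) :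
    wordProb p w ≤ 1 := by
  induction w with
  | nil => simp
  | cons a w ih =>
    rw [wordProb_cons]
    exact mul_le_one₀ (letter_le_one hp hp1 a) (wordProb_pos hp w).le ih

/-! ### The law of the strings -/

lemma isProbabilityMeasure_letterLaw (hp : ∀ j, 0 < p j) (hp1 : ∑ j, p j = 1) :
    IsProbabilityMeasure (letterLaw p) := by
  constructor
  simp only [letterLaw, Measure.coe_finsetSum, Finset.sum_apply, Measure.smul_apply, smul_eq_mul,
    measure_univ, mul_one]
  rw [← ENNReal.ofReal_sum_of_nonneg fun j _ => (hp j).le, hp1, ENNReal.ofReal_one]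

lemma letterLaw_singleton (a : Fin m) : letterLaw p {a} = ENNReal.ofReal (p a) := by
  simp only [letterLaw, Measure.coe_finsetSum, Finset.sum_apply, Measure.smul_apply, smul_eq_mul]
  rw [Finset.sum_eq_single a]
  · simp
  · intro b _ hb
    simp [hb]
  · simp

lemma map_shift_infinitePi (μ : Measure (Fin m)) [IsProbabilityMeasure μ] (l : ℕ) :
    (Measure.infinitePi fun _ : ℕ => μ).map (fun x k => x (k + l)) =
      Measure.infinitePi fun _ : ℕ => μ :=
  Measure.map_infinitePi_infinitePi_of_inj (P := fun _ : ℕ => μ) (add_left_injective l)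

/-- Deleting the first `l` letters of all strings and reindexing the strings injectively preserves
the law. -/
lemma map_reindex_shift_stringsLaw (hp : ∀ j, 0 < p j) (hp1 : ∑ j, p j = 1) {e : ℕ → ℕ}
    (he : Function.Injective e) (l : ℕ) :
    (stringsLaw p).map (fun ω i k => ω (e i) (k + l)) = stringsLaw p := by
  have := isProbabilityMeasure_letterLaw hp hp1
  have h1 : (stringsLaw p).map (fun ω i => ω (e i)) = stringsLaw p :=
    Measure.map_infinitePi_infinitePi_of_inj
      (P := fun _ : ℕ => Measure.infinitePi fun _ : ℕ => letterLaw p) he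
  have h2 : (stringsLaw p).map (fun ω i k => ω i (k + l)) = stringsLaw p := by
    have := Measure.infinitePi_map_pi (X := fun _ : ℕ => ℕ → Fin m) (Y := fun _ => ℕ → Fin m)
      (fun _ : ℕ => Measure.infinitePi fun _ : ℕ => letterLaw p)
      (f := fun _ x k => x (k + l)) (fun _ => by fun_prop)
    rw [stringsLaw, this]
    simp_rw [map_shift_infinitePi]
  have h3 : (fun (ω : ℕ → ℕ → Fin m) i k => ω (e i) (k + l)) =
      (fun ω i k => ω i (k + l)) ∘ (fun ω i => ω (e i)) := rfl
  rw [h3, ← Measure.map_map (by fun_prop) (by fun_prop), h1, h2]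

lemma isProbabilityMeasure_stringsLaw (hp : ∀ j, 0 < p j) (hp1 : ∑ j, p j = 1) :
    IsProbabilityMeasure (stringsLaw p) := by
  have := isProbabilityMeasure_letterLaw hp hp1
  unfold stringsLaw
  infer_instance

/-- The string `x` starts with the word `w`. -/
def HasPrefix (w : List (Fin m)) (x : ℕ → Fin m) : Prop := ∀ k : Fin w.length, x k = w.get k

lemma measurableSet_hasPrefix (w : List (Fin m)) : MeasurableSet {x | HasPrefix w x} := by
  simp only [HasPrefix, Set.ofPred_forall]
  exact MeasurableSet.iInter fun k => measurable_pi_apply _ (MeasurableSet.singleton _)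

lemma infinitePi_hasPrefix (hp : ∀ j, 0 < p j) (hp1 : ∑ j, p j = 1) (w : List (Fin m)) :
    (Measure.infinitePi fun _ : ℕ => letterLaw p) {x | HasPrefix w x} =
      ENNReal.ofReal (wordProb p w) := by
  have := isProbabilityMeasure_letterLaw hp hp1
  have h : {x | HasPrefix w x} =
      Set.pi (Finset.range w.length) (fun k => {x : Fin m | ∀ h : k < w.length, x = w[k]}) := by
    ext x
    simp only [HasPrefix, Set.mem_ofPred_eq, Set.mem_pi, Finset.coe_range, Set.mem_Iio]
    exact ⟨fun H k hk _ => H ⟨k, hk⟩, fun H k => H k k.2 k.2⟩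
  rw [h, Measure.infinitePi_pi _ (fun _ _ => MeasurableSet.of_discrete), Finset.prod_range]
  have h' : ∀ k : Fin w.length,
      letterLaw p {x : Fin m | ∀ h : (k : ℕ) < w.length, x = w[(k : ℕ)]} =
        ENNReal.ofReal (p w[k]) := by
    intro k
    rw [← letterLaw_singleton]
    congr 1
    ext x
    simp
  simp_rw [h']
  rw [← ENNReal.ofReal_prod_of_nonneg fun k _ => (hp _).le, wordProb]
  congr 1
  exact Fin.prod_univ_fun_getElem w p

lemma mem_withPrefix {ω : ℕ → ℕ → Fin m} {n i : ℕ} {w : List (Fin m)} :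
    i ∈ withPrefix ω n w ↔ i < n ∧ HasPrefix w (ω i) := by
  simp [withPrefix, HasPrefix]

/-- The event is a box, with one condition for each string, so its measure is a product. -/
lemma setOf_withPrefix_eq {n : ℕ} {w : List (Fin m)} {I : Finset ℕ} (hI : I ⊆ Finset.range n) :
    {ω : ℕ → ℕ → Fin m | withPrefix ω n w = I} =
      Set.pi (Finset.range n)
        (fun i => if i ∈ I then {x | HasPrefix w x} else {x | HasPrefix w x}ᶜ) := by
  ext ω
  simp only [Set.mem_ofPred_eq, Set.mem_pi, Finset.coe_range, Set.mem_Iio, Finset.ext_iff,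
    mem_withPrefix]
  constructor
  · intro h i hi
    by_cases hiI : i ∈ I
    · simpa [hiI] using ((h i).2 hiI).2
    · simp only [hiI, if_false, Set.mem_compl_iff, Set.mem_ofPred_eq]
      exact fun H => hiI ((h i).1 ⟨hi, H⟩)
  · intro h i
    by_cases hiI : i ∈ I
    · have hin := Finset.mem_range.1 (hI hiI)
      simpa [hiI, hin] using h i hin
    · simp only [hiI, iff_false, not_and]
      intro hin
      simpa [hiI] using h i hin

lemma stringsLaw_withPrefix_eq (hp : ∀ j, 0 < p j) (hp1 : ∑ j, p j = 1) {n : ℕ}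
    (w : List (Fin m)) {I : Finset ℕ} (hI : I ⊆ Finset.range n) :
    stringsLaw p {ω | withPrefix ω n w = I} =
      ENNReal.ofReal (wordProb p w ^ I.card * (1 - wordProb p w) ^ (n - I.card)) := by
  have := isProbabilityMeasure_letterLaw hp hp1
  have h1 := wordProb_le_one hp hp1 w
  have h0 := (wordProb_pos hp w).le
  have hm := measurableSet_hasPrefix (m := m) w
  rw [setOf_withPrefix_eq hI, stringsLaw, Measure.infinitePi_pi]
  · rw [← Finset.prod_sdiff hI, Finset.prod_congr rfl (g := fun _ =>
      ENNReal.ofReal (1 - wordProb p w)), Finset.prod_congr (s₁ := I) rfl (g := fun _ =>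
      ENNReal.ofReal (wordProb p w))]
    · rw [Finset.prod_const, Finset.prod_const, Finset.card_sdiff_of_subset hI, Finset.card_range,
        mul_comm, ENNReal.ofReal_mul (by positivity), ENNReal.ofReal_pow h0,
        ENNReal.ofReal_pow (by linarith)]
    · intro i hi
      simp [hi, infinitePi_hasPrefix hp hp1]
    · intro i hi
      simp only [Finset.mem_sdiff] at hi
      simp only [hi.2, if_false]
      rw [prob_compl_eq_one_sub hm, infinitePi_hasPrefix hp hp1,
        ENNReal.ofReal_sub _ h0, ENNReal.ofReal_one]
  · intro i _
    split_ifs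
    exacts [hm, hm.compl]

/-! ### Trie shapes -/

/-- Letters partition the strings among the subtrees. This is what restricts the strings below an
occurrence of `T` to subsets of fixed cardinality. -/
lemma HasShape.card_eq {ω : ℕ → ℕ → Fin m} {T : Shape m} {I : Finset ℕ} {l : ℕ}
    (h : HasShape ω T I l) : I.card = T.size := by
  induction T generalizing I l with
  | empty => exact h
  | leaf => exact h
  | node c ih =>
    obtain ⟨-, h⟩ := h
    rw [Shape.size, Finset.card_eq_sum_card_fiberwise (f := fun i => ω i l) (t := Finset.univ)
      (fun _ _ => Finset.mem_coe.2 (Finset.mem_univ _))]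
    exact Finset.sum_congr rfl fun a _ => ih a (h a)

lemma hasShape_map_iff (ω : ℕ → ℕ → Fin m) (e : ℕ ↪ ℕ) (l : ℕ) (T : Shape m) (I : Finset ℕ)
    (k : ℕ) :
    HasShape ω T (I.map e) (k + l) ↔ HasShape (fun i k => ω (e i) (k + l)) T I k := by
  induction T generalizing I k with
  | empty => simp [HasShape]
  | leaf => simp [HasShape]
  | node c ih =>
    simp only [HasShape, Finset.card_map]
    refine and_congr_right fun _ => forall_congr' fun a => ?_
    rw [← ih, Finset.filter_map, add_right_comm]
    rfl

lemma measurableSet_hasShape (T : Shape m) (I : Finset ℕ) (l : ℕ) :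
    MeasurableSet {ω : ℕ → ℕ → Fin m | HasShape ω T I l} := by
  induction T generalizing I l with
  | empty => exact MeasurableSet.const _
  | leaf => exact MeasurableSet.const _
  | node c ih =>
    -- The filtered index set is random, so the event is split over its finitely many possible
    -- values `J`.
    have h : {ω : ℕ → ℕ → Fin m | HasShape ω (.node c) I l} = {_ω | 2 ≤ I.card} ∩
        ⋂ a, ⋃ J ∈ I.powerset, {ω | ∀ i ∈ I, i ∈ J ↔ ω i l = a} ∩ {ω | HasShape ω (c a) J (l + 1)} := by
      ext ω
      simp only [HasShape, Set.mem_ofPred_eq, Set.mem_inter_iff, Set.mem_iInter, Set.mem_iUnion,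
        Finset.mem_powerset, exists_prop]
      refine and_congr_right fun _ => forall_congr' fun a => ⟨fun h => ?_, ?_⟩
      · exact ⟨_, Finset.filter_subset _ _, fun i hi => by simp [hi], h⟩
      · rintro ⟨J, hJ, h1, h2⟩
        convert h2 using 1
        ext i
        simp only [Finset.mem_filter]
        exact ⟨fun h => (h1 i h.1).2 h.2, fun h => ⟨hJ h, (h1 i (hJ h)).1 h⟩⟩
    rw [h]
    refine (MeasurableSet.const _).inter (MeasurableSet.iInter fun a =>
      Finset.measurableSet_biUnion _ fun J _ => MeasurableSet.inter ?_ (ih a J (l + 1)))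
    simp only [Set.ofPred_forall]
    refine Finset.measurableSet_biInter _ fun i _ => ?_
    have : Measurable fun ω : ℕ → ℕ → Fin m => ω i l := by fun_prop
    exact this (MeasurableSet.of_discrete (s := {x | i ∈ J ↔ x = a}))

lemma exists_embedding_map_range (I : Finset ℕ) :
    ∃ e : ℕ ↪ ℕ, (Finset.range I.card).map e = I := by
  classical
  -- The reindexing must be injective on all of ℕ to preserve the law, so the remaining indices are
  -- sent beyond the maximum of `I`.
  let g : ℕ → ℕ := fun i => if h : i < I.card then I.orderEmbOfFin rfl ⟨i, h⟩ else I.sup id + 1 + i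
  have hlt : ∀ i (h : i < I.card), I.orderEmbOfFin rfl ⟨i, h⟩ ≤ I.sup id := fun i h =>
    Finset.le_sup (f := id) (Finset.orderEmbOfFin_mem I rfl ⟨i, h⟩)
  have hg : Function.Injective g := by
    intro i j hij
    simp only [g] at hij
    split_ifs at hij with h1 h2 h2
    · simpa using hij
    · have := hlt i h1; omega
    · have := hlt j h2; omega
    · omega
  refine ⟨⟨g, hg⟩, Finset.eq_of_subset_of_card_le ?_ (by simp)⟩
  intro x hx
  simp only [Finset.mem_map, Finset.mem_range, Function.Embedding.coeFn_mk] at hx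
  obtain ⟨i, hi, rfl⟩ := hx
  simp only [g, hi, dif_pos]
  exact Finset.orderEmbOfFin_mem I rfl ⟨i, hi⟩

/-- The law is invariant under choosing strings and deleting initial letters, so only the number of
strings matters. -/
lemma stringsLaw_hasShape (hp : ∀ j, 0 < p j) (hp1 : ∑ j, p j = 1) (T : Shape m) {I : Finset ℕ}
    (hI : I.card = T.size) (l : ℕ) :
    stringsLaw p {ω | HasShape ω T I l} = ENNReal.ofReal (shapeFunctional p T) := by
  have := isProbabilityMeasure_stringsLaw hp hp1
  obtain ⟨e, he⟩ := exists_embedding_map_range I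
  rw [hI] at he
  have h : {ω : ℕ → ℕ → Fin m | HasShape ω T I l} = (fun ω i k => ω (e i) (k + l)) ⁻¹'
      {ω | HasShape ω T (Finset.range T.size) 0} := by
    ext ω
    rw [Set.mem_preimage, Set.mem_ofPred_eq, Set.mem_ofPred_eq, ← hasShape_map_iff, he, zero_add]
  rw [h, ← Measure.map_apply (by fun_prop) (measurableSet_hasShape T _ _),
    map_reindex_shift_stringsLaw hp hp1 e.injective, shapeFunctional, ofReal_measureReal]

/-! ### Independence of the prefixes and the later letters -/

/-- The σ-algebra generated by the letters `ω i k` with `(i, k) ∈ S`. -/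
abbrev letterAlgebra (m : ℕ) (S : Set (ℕ × ℕ)) : MeasurableSpace (ℕ → ℕ → Fin m) :=
  ⨆ q ∈ S, MeasurableSpace.comap (fun ω => ω q.1 q.2) ⊤

lemma measurable_letterAlgebra {S : Set (ℕ × ℕ)} {i k : ℕ} (h : (i, k) ∈ S) :
    Measurable[letterAlgebra m S] (fun ω : ℕ → ℕ → Fin m => ω i k) :=
  Measurable.mono (comap_measurable _)
    (le_iSup₂_of_le (f := fun q (_ : q ∈ S) =>
      MeasurableSpace.comap (fun ω : ℕ → ℕ → Fin m => ω q.1 q.2) ⊤) (i, k) h le_rfl) le_rfl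

lemma indep_letterAlgebra (hp : ∀ j, 0 < p j) (hp1 : ∑ j, p j = 1) {S S' : Set (ℕ × ℕ)}
    (h : Disjoint S S') :
    Indep (letterAlgebra m S) (letterAlgebra m S') (stringsLaw p) := by
  have := isProbabilityMeasure_letterLaw hp hp1
  refine indep_iSup_of_disjoint
    (m := fun q : ℕ × ℕ => MeasurableSpace.comap (fun ω : ℕ → ℕ → Fin m => ω q.1 q.2) ⊤)
    (fun q => Measurable.comap_le ?_) ?_ h
  · exact (measurable_pi_apply q.2).comp (measurable_pi_apply q.1)
  · exact iIndepFun_uncurry_infinitePi' (X := fun _ _ x => x) (fun _ _ : ℕ => letterLaw p)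
      (fun _ _ => measurable_id)

lemma measurableSet_letterAlgebra_withPrefix {n : ℕ} {I : Finset ℕ} (hI : I ⊆ Finset.range n)
    (w : List (Fin m)) :
    MeasurableSet[letterAlgebra m {q | q.2 < w.length}] {ω | withPrefix ω n w = I} := by
  have : {ω : ℕ → ℕ → Fin m | withPrefix ω n w = I} =
      ⋂ i ∈ Finset.range n, {ω | i ∈ I ↔ ∀ k : Fin w.length, ω i k = w.get k} := by
    ext ω
    simp only [Set.mem_ofPred_eq, Set.mem_iInter, Finset.mem_range, Finset.ext_iff,
      mem_withPrefix, HasPrefix]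
    constructor
    · intro h i hi
      rw [← h i]
      simp [hi]
    · intro h i
      by_cases hi : i < n
      · rw [h i hi]
        simp [hi]
      · have : i ∉ I := fun H => hi (Finset.mem_range.1 (hI H))
        simp [hi, this]
  rw [this]
  refine Finset.measurableSet_biInter _ fun i _ => ?_
  have hk : MeasurableSet[letterAlgebra m {q | q.2 < w.length}]
      {ω : ℕ → ℕ → Fin m | ∀ k : Fin w.length, ω i k = w.get k} := by
    simp only [Set.ofPred_forall]
    refine MeasurableSet.iInter fun k => ?_
    exact measurable_letterAlgebra (S := {q | q.2 < w.length}) k.2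
      (MeasurableSet.singleton (w.get k))
  by_cases hiI : i ∈ I
  · simpa only [hiI, true_iff] using hk
  · simp only [hiI, false_iff]
    exact hk.compl

lemma measurableSet_letterAlgebra_hasShape (T : Shape m) (I : Finset ℕ) (l : ℕ) :
    MeasurableSet[letterAlgebra m {q | l ≤ q.2}] {ω | HasShape ω T I l} := by
  have : {ω : ℕ → ℕ → Fin m | HasShape ω T I l} =
      (fun ω i k => ω i (k + l)) ⁻¹' {ω | HasShape ω T I 0} := by
    ext ω
    have := hasShape_map_iff ω (Function.Embedding.refl ℕ) l T I 0
    simpa using this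
  rw [this]
  have hm : Measurable[letterAlgebra m {q | l ≤ q.2}]
      (fun (ω : ℕ → ℕ → Fin m) i k => ω i (k + l)) :=
    @measurable_pi_lambda _ _ _ (_) _ _ fun i => @measurable_pi_lambda _ _ _ (_) _ _ fun k =>
      measurable_letterAlgebra (S := {q | l ≤ q.2}) (Nat.le_add_left _ _)
  exact hm (measurableSet_hasShape T I 0)

/-- The prefixes of the strings are independent of the later letters. -/
lemma stringsLaw_inter_withPrefix_hasShape (hp : ∀ j, 0 < p j) (hp1 : ∑ j, p j = 1) (T : Shape m)
    {I : Finset ℕ} {n : ℕ} (hI : I ⊆ Finset.range n) (w : List (Fin m)) :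
    stringsLaw p ({ω | withPrefix ω n w = I} ∩ {ω | HasShape ω T I w.length}) =
      stringsLaw p {ω | withPrefix ω n w = I} * stringsLaw p {ω | HasShape ω T I w.length} := by
  have hdisj : Disjoint {q : ℕ × ℕ | q.2 < w.length} {q : ℕ × ℕ | w.length ≤ q.2} :=
    Set.disjoint_left.2 fun q h1 h2 => absurd (show q.2 < w.length from h1)
      (not_lt.2 (show w.length ≤ q.2 from h2))
  exact (Indep_iff _ _ _).1 (indep_letterAlgebra hp hp1 hdisj) _ _
    (measurableSet_letterAlgebra_withPrefix hI w) (measurableSet_letterAlgebra_hasShape T I _)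

/-- The probability that the motif `T` occurs at the node `w`. -/
lemma stringsLaw_hasShape_withPrefix (hp : ∀ j, 0 < p j) (hp1 : ∑ j, p j = 1) (T : Shape m)
    (n : ℕ) (w : List (Fin m)) :
    MeasurableSet {ω | HasShape ω T (withPrefix ω n w) w.length} ∧
    stringsLaw p {ω | HasShape ω T (withPrefix ω n w) w.length} =
      ENNReal.ofReal (shapeFunctional p T *
        (n.choose T.size * wordProb p w ^ T.size * (1 - wordProb p w) ^ (n - T.size))) := by
  -- Condition on which strings have prefix `w`: the pieces are disjoint and equally likely, and
  -- there are `n.choose T.size` of them.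
  have h : {ω : ℕ → ℕ → Fin m | HasShape ω T (withPrefix ω n w) w.length} =
      ⋃ I ∈ (Finset.range n).powersetCard T.size,
        {ω | withPrefix ω n w = I} ∩ {ω | HasShape ω T I w.length} := by
    ext ω
    simp only [Set.mem_ofPred_eq, Set.mem_iUnion, Finset.mem_powersetCard, Set.mem_inter_iff,
      exists_prop]
    constructor
    · intro H
      exact ⟨_, ⟨Finset.filter_subset _ _, H.card_eq⟩, rfl, H⟩
    · rintro ⟨I, -, rfl, H⟩
      exact H
  have hmeas : ∀ I ∈ (Finset.range n).powersetCard T.size, MeasurableSet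
      ({ω : ℕ → ℕ → Fin m | withPrefix ω n w = I} ∩ {ω | HasShape ω T I w.length}) := by
    intro I hI
    rw [Finset.mem_powersetCard] at hI
    refine MeasurableSet.inter ?_ (measurableSet_hasShape _ _ _)
    rw [setOf_withPrefix_eq hI.1]
    refine MeasurableSet.pi (Finset.countable_toSet _) fun i _ => ?_
    split_ifs
    exacts [measurableSet_hasPrefix w, (measurableSet_hasPrefix w).compl]
  rw [h]
  refine ⟨Finset.measurableSet_biUnion _ hmeas, ?_⟩
  rw [measure_biUnion_finset _ hmeas]
  · rw [Finset.sum_congr rfl (g := fun _ => ENNReal.ofReal (shapeFunctional p T *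
      (wordProb p w ^ T.size * (1 - wordProb p w) ^ (n - T.size))))]
    · rw [Finset.sum_const, Finset.card_powersetCard, Finset.card_range, nsmul_eq_mul,
        ← ENNReal.ofReal_natCast, ← ENNReal.ofReal_mul (by positivity)]
      congr 1
      ring
    · intro I hI
      rw [Finset.mem_powersetCard] at hI
      rw [stringsLaw_inter_withPrefix_hasShape hp hp1 T hI.1, stringsLaw_withPrefix_eq hp hp1 w hI.1,
        stringsLaw_hasShape hp hp1 T hI.2, hI.2,
        ENNReal.ofReal_mul (show 0 ≤ shapeFunctional p T from measureReal_nonneg), mul_comm]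
  · intro I _ J _ hIJ
    refine Set.disjoint_left.2 ?_
    rintro ω ⟨h1, -⟩ ⟨h2, -⟩
    exact hIJ (h1.symm.trans h2)

/-! ### From node probabilities to the mean -/

/-- Both `Set.ncard` and `toReal` send infinity to `0`, so no finiteness is required; working in
`ℝ≥0∞` makes the exchange of sum and integral free. -/
lemma fringeCount_eq_toReal_tsum (n : ℕ) (T : Shape m) (ω : ℕ → ℕ → Fin m) :
    (fringeCount n T ω : ℝ) = (∑' w : List (Fin m),
      {ω | HasShape ω T (withPrefix ω n w) w.length}.indicator (fun _ => (1 : ℝ≥0∞)) ω).toReal := by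
  set s := {w : List (Fin m) | HasShape ω T (withPrefix ω n w) w.length} with hs
  have h : ∑' w : List (Fin m),
      {ω | HasShape ω T (withPrefix ω n w) w.length}.indicator (fun _ => (1 : ℝ≥0∞)) ω =
        s.encard := by
    rw [← ENNReal.tsum_set_one, tsum_subtype s (fun _ => (1 : ℝ≥0∞))]
    rfl
  rw [h, fringeCount, Set.ncard]
  cases hc : s.encard with
  | top => simp
  | coe k => simp

/-- The mean number of occurrences as a sum over all words. -/
lemma integrable_fringeCount_and_integral_eq (hp : ∀ j, 0 < p j) (hp1 : ∑ j, p j = 1)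
    (T : Shape m) (n : ℕ)
    (hs : Summable fun w => (n.choose T.size : ℝ) * wordProb p w ^ T.size *
      (1 - wordProb p w) ^ (n - T.size)) :
    Integrable (fun ω => (fringeCount n T ω : ℝ)) (stringsLaw p) ∧
    ∫ ω, (fringeCount n T ω : ℝ) ∂(stringsLaw p) = shapeFunctional p T *
      ∑' w, (n.choose T.size : ℝ) * wordProb p w ^ T.size *
        (1 - wordProb p w) ^ (n - T.size) := by
  simp_rw [fringeCount_eq_toReal_tsum]
  have hQ : 0 ≤ shapeFunctional p T := measureReal_nonneg
  have hpos : ∀ w, 0 ≤ shapeFunctional p T * ((n.choose T.size : ℝ) * wordProb p w ^ T.size *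
      (1 - wordProb p w) ^ (n - T.size)) := fun w => by
    have := wordProb_pos hp w
    have : 0 ≤ 1 - wordProb p w := by linarith [wordProb_le_one hp hp1 w]
    positivity
  have hmeas : ∀ w : List (Fin m), Measurable
      ({ω | HasShape ω T (withPrefix ω n w) w.length}.indicator (fun _ => (1 : ℝ≥0∞))) := fun w =>
    measurable_const.indicator (stringsLaw_hasShape_withPrefix hp hp1 T n w).1
  have hF : Measurable fun ω : ℕ → ℕ → Fin m => ∑' w : List (Fin m),
      {ω | HasShape ω T (withPrefix ω n w) w.length}.indicator (fun _ => (1 : ℝ≥0∞)) ω :=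
    Measurable.tsum hmeas
  have h_integral : ∫⁻ ω, ∑' w : List (Fin m),
      {ω | HasShape ω T (withPrefix ω n w) w.length}.indicator (fun _ => (1 : ℝ≥0∞)) ω
        ∂(stringsLaw p) = ENNReal.ofReal (shapeFunctional p T *
      ∑' w, (n.choose T.size : ℝ) * wordProb p w ^ T.size *
        (1 - wordProb p w) ^ (n - T.size)) := by
    rw [lintegral_tsum fun w => (hmeas w).aemeasurable, ← tsum_mul_left,
      ENNReal.ofReal_tsum_of_nonneg hpos (hs.mul_left _)]
    refine tsum_congr fun w => ?_
    rw [lintegral_indicator_const (stringsLaw_hasShape_withPrefix hp hp1 T n w).1, one_mul,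
      (stringsLaw_hasShape_withPrefix hp hp1 T n w).2]
  have htop : ∫⁻ ω, ∑' w : List (Fin m),
      {ω | HasShape ω T (withPrefix ω n w) w.length}.indicator (fun _ => (1 : ℝ≥0∞)) ω
        ∂(stringsLaw p) ≠ ∞ := by
    rw [h_integral]
    exact ENNReal.ofReal_ne_top
  refine ⟨integrable_toReal_of_lintegral_ne_top hF.aemeasurable htop, ?_⟩
  rw [integral_toReal hF.aemeasurable (ae_lt_top hF htop), h_integral, ENNReal.toReal_ofReal]
  rw [← tsum_mul_left]
  exact tsum_nonneg hpos

/-! ### Sums over words -/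

/-- If `a` is a supersolution of the recursion `g x = b x + ∑ j, g (p j * x)`, then it dominates the
sum of `b (x * wordProb p w)` over words. -/
lemma sum_words_le_of_supersolution (hp : ∀ j, 0 < p j) {a b : ℝ → ℝ}
    (ha : ∀ x, 0 ≤ x → 0 ≤ a x) (hb : ∀ x, 0 ≤ x → 0 ≤ b x)
    (hab : ∀ x, 0 ≤ x → b x + ∑ j, a (p j * x) ≤ a x) (s : Finset (List (Fin m))) {x : ℝ}
    (hx : 0 ≤ x) : ∑ w ∈ s, b (x * wordProb p w) ≤ a x := by
  -- Induction on the maximal word length: sorting the words by first letter reproduces the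
  -- recursion at the points `p j * x`.
  suffices H : ∀ k : ℕ, ∀ (s : Finset (List (Fin m))), (∀ w ∈ s, w.length < k) → ∀ x : ℝ, 0 ≤ x →
      ∑ w ∈ s, b (x * wordProb p w) ≤ a x from
    H (s.sup List.length + 1) s (fun w hw => Nat.lt_succ_of_le (Finset.le_sup hw)) x hx
  intro k
  induction k with
  | zero =>
    intro s hs x hx
    have : s = ∅ := Finset.eq_empty_of_forall_notMem fun w hw => by simpa using hs w hw
    simpa [this] using ha x hx
  | succ k ih =>
    intro s hs x hx
    rw [← Finset.sum_fiberwise s List.head?, Fintype.sum_option]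
    refine le_trans (add_le_add ?_ (Finset.sum_le_sum fun j _ => ?_)) (hab x hx)
    · calc ∑ w ∈ s with w.head? = none, b (x * wordProb p w)
          ≤ ∑ w ∈ {[]}, b (x * wordProb p w) := by
            refine Finset.sum_le_sum_of_subset_of_nonneg ?_ fun w _ _ =>
              hb _ (mul_nonneg hx (wordProb_pos hp w).le)
            intro w hw
            simpa using (Finset.mem_filter.1 hw).2
        _ = b x := by simp
    · have hw : ∀ w ∈ s.filter (fun w => w.head? = some j), w = j :: w.tail := by
        intro w hw
        exact (List.cons_head?_tail (Finset.mem_filter.1 hw).2).symm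
      have h1 : ∑ w ∈ s with w.head? = some j, b (x * wordProb p w) =
          ∑ v ∈ (s.filter (fun w => w.head? = some j)).image List.tail,
            b (p j * x * wordProb p v) := by
        rw [Finset.sum_image]
        · refine Finset.sum_congr rfl fun w h => ?_
          conv_lhs => rw [hw w h, wordProb_cons]
          congr 1
          ring
        · intro u hu v hv huv
          rw [hw u hu, hw v hv, huv]
      rw [h1]
      refine ih _ ?_ _ (mul_nonneg (hp j).le hx)
      intro v hv
      obtain ⟨w, h, rfl⟩ := Finset.mem_image.1 hv
      have h2 := hs w (Finset.mem_filter.1 h).1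
      have h3 := congrArg List.length (hw w h)
      rw [List.length_cons] at h3
      omega

lemma tsum_words_eq {F : List (Fin m) → ℝ} (hF : Summable F) :
    ∑' w, F w = F [] + ∑ j, ∑' w, F (j :: w) := by
  let e : Unit ⊕ (Fin m × List (Fin m)) ≃ List (Fin m) :=
    { toFun := Sum.elim (fun _ => []) (fun q => q.1 :: q.2)
      invFun := fun w => match w with
        | [] => Sum.inl ()
        | a :: w => Sum.inr (a, w)
      left_inv := by rintro (_ | ⟨a, w⟩) <;> rfl
      right_inv := by rintro (_ | ⟨a, w⟩) <;> rfl }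
  have h1 : Summable (F ∘ e) := (e.summable_iff).2 hF
  have h2 : Summable fun q : Fin m × List (Fin m) => F (q.1 :: q.2) :=
    h1.comp_injective Sum.inr_injective
  have h3 : HasSum (F ∘ e) (F [] + ∑' q : Fin m × List (Fin m), F (q.1 :: q.2)) := by
    refine HasSum.sum (f := F ∘ e) ?_ ?_
    · exact hasSum_unique (fun _ : Unit => F []) _
    · exact h2.hasSum
  rw [((e.hasSum_iff).1 h3).tsum_eq, h2.tsum_prod, tsum_fintype]

/-! ### The dominating function -/

/-- A function dominating `x ^ i * exp (-x)` for `2 ≤ i` up to a constant. -/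
def envelope (x : ℝ) : ℝ := x ^ 2 / (1 + x) ^ 2

lemma envelope_nonneg (x : ℝ) : 0 ≤ envelope x := by unfold envelope; positivity

lemma letter_lt_one (hm : 2 ≤ m) (hp : ∀ j, 0 < p j) (hp1 : ∑ j, p j = 1) (j : Fin m) :
    p j < 1 := by
  have : Nontrivial (Fin m) := Fin.nontrivial_iff_two_le.2 hm
  obtain ⟨i, hi⟩ := exists_ne j
  rw [← hp1]
  exact Finset.single_lt_sum hi (Finset.mem_univ j) (Finset.mem_univ i) (hp i)
    fun k _ _ => (hp k).le

/-- The function x²/(1+x) is a supersolution: p·x²/(1+x) - (px)²/(1+px) equals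
p(1-p)x²/((1+x)(1+px)), which is at least p(1-p) times the envelope. Being at most x and at most x²,
it yields both linear growth at infinity and decay near zero. -/
lemma exists_envelope_bound (hm : 2 ≤ m) (hp : ∀ j, 0 < p j) (hp1 : ∑ j, p j = 1) :
    ∃ κ : ℝ, 0 < κ ∧ ∀ x, 0 ≤ x → (Summable fun w => envelope (x * wordProb p w)) ∧
      ∑' w, envelope (x * wordProb p w) ≤ κ * (x ^ 2 / (1 + x)) := by
  set c := ∑ j, p j * (1 - p j) with hc
  have hc0 : 0 < c := by
    have hne : (Finset.univ : Finset (Fin m)).Nonempty := ⟨⟨0, by omega⟩, Finset.mem_univ _⟩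
    refine Finset.sum_pos (fun j _ => mul_pos (hp j) ?_) hne
    linarith [letter_lt_one hm hp hp1 j]
  have hsup : ∀ x, 0 ≤ x → c * envelope x + ∑ j, (p j * x) ^ 2 / (1 + p j * x) ≤
      x ^ 2 / (1 + x) := by
    intro x hx
    have hj : ∀ j, p j * (1 - p j) * envelope x + (p j * x) ^ 2 / (1 + p j * x) ≤
        p j * (x ^ 2 / (1 + x)) := by
      intro j
      have h0 := hp j
      have h1 := letter_le_one hp hp1 j
      have hpx : 0 ≤ p j * x := by positivity
      have hle : p j * x ≤ x := by nlinarith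
      have e : p j * (x ^ 2 / (1 + x)) - (p j * x) ^ 2 / (1 + p j * x) =
          p j * (1 - p j) * (x ^ 2 / ((1 + x) * (1 + p j * x))) := by
        field_simp
        ring
      have : envelope x ≤ x ^ 2 / ((1 + x) * (1 + p j * x)) := by
        unfold envelope
        rw [sq (1 + x)]
        gcongr
      have := mul_le_mul_of_nonneg_left this (mul_nonneg h0.le (by linarith : 0 ≤ 1 - p j))
      linarith
    calc c * envelope x + ∑ j, (p j * x) ^ 2 / (1 + p j * x)
        = ∑ j, (p j * (1 - p j) * envelope x + (p j * x) ^ 2 / (1 + p j * x)) := by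
          rw [Finset.sum_add_distrib, hc, Finset.sum_mul]
      _ ≤ ∑ j, p j * (x ^ 2 / (1 + x)) := Finset.sum_le_sum fun j _ => hj j
      _ = x ^ 2 / (1 + x) := by rw [← Finset.sum_mul, hp1, one_mul]
  have hfin : ∀ x, 0 ≤ x → ∀ s : Finset (List (Fin m)),
      ∑ w ∈ s, envelope (x * wordProb p w) ≤ c⁻¹ * (x ^ 2 / (1 + x)) := by
    intro x hx s
    have := sum_words_le_of_supersolution hp (a := fun x => x ^ 2 / (1 + x))
      (b := fun x => c * envelope x) (fun x hx => by positivity)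
      (fun x _ => mul_nonneg hc0.le (envelope_nonneg x)) hsup s hx
    rw [← Finset.mul_sum] at this
    rwa [le_inv_mul_iff₀ hc0]
  refine ⟨c⁻¹, by positivity, fun x hx => ?_⟩
  have hs : Summable fun w => envelope (x * wordProb p w) :=
    summable_of_sum_le (fun w => envelope_nonneg _) (hfin x hx)
  exact ⟨hs, hs.tsum_le_of_sum_le (hfin x hx)⟩

/-- One term of the exponential series at `1 + x` bounds (1+x)^i e^(-x) by e·i!. -/
lemma pow_mul_exp_neg_le_envelope {i : ℕ} (hi : 2 ≤ i) {x : ℝ} (hx : 0 ≤ x) :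
    x ^ i * Real.exp (-x) ≤ Real.exp 1 * i.factorial * envelope x := by
  have h1 := Real.pow_div_factorial_le_exp (1 + x) (by linarith) i
  rw [div_le_iff₀ (by positivity), Real.exp_add] at h1
  have h2 : (1 + x) ^ i * Real.exp (-x) ≤ Real.exp 1 * i.factorial := by
    rw [Real.exp_neg, ← div_eq_mul_inv, div_le_iff₀ (Real.exp_pos x)]
    linarith
  have h3 : x ^ i ≤ envelope x * (1 + x) ^ i := by
    obtain ⟨k, rfl⟩ := Nat.exists_eq_add_of_le hi
    have : envelope x * (1 + x) ^ (2 + k) = x ^ 2 * (1 + x) ^ k := by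
      unfold envelope
      rw [pow_add]
      field_simp
    rw [this, pow_add]
    gcongr
    linarith
  calc x ^ i * Real.exp (-x) ≤ envelope x * (1 + x) ^ i * Real.exp (-x) := by gcongr
    _ = (1 + x) ^ i * Real.exp (-x) * envelope x := by ring
    _ ≤ _ := mul_le_mul_of_nonneg_right h2 (envelope_nonneg x)

/-! ### Comparison of the binomial and the Poisson weights -/

/-- The Poisson weight at `τ`. -/
def poissonWeight (τ : ℕ) (x : ℝ) : ℝ := x ^ τ * Real.exp (-x) / τ.factorial

lemma poissonWeight_nonneg (τ : ℕ) {x : ℝ} (hx : 0 ≤ x) : 0 ≤ poissonWeight τ x := by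
  unfold poissonWeight; positivity

lemma poissonWeight_le_envelope {τ : ℕ} (hτ : 2 ≤ τ) {x : ℝ} (hx : 0 ≤ x) :
    poissonWeight τ x ≤ Real.exp 1 * envelope x := by
  unfold poissonWeight
  rw [div_le_iff₀ (by positivity)]
  linarith [pow_mul_exp_neg_le_envelope hτ hx]

/-- From below, 1 - y ≥ e^(-y)(1 - y²) and Bernoulli; from above, 1 - y ≤ e^(-y), with a correction
e^(τy) for the missing factors. Keeping e^(-ny) in the error lets the envelope absorb the powers of
ny. -/
lemma abs_one_sub_pow_sub_exp_le {n τ : ℕ} (hn : 0 < n) (hτ : τ ≤ n) {y : ℝ} (hy : 0 ≤ y)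
    (hy1 : y ≤ 1) :
    |(1 - y) ^ (n - τ) - Real.exp (-(n * y))| ≤
      Real.exp (-(n * y)) * ((τ * Real.exp τ * (n * y) + (n * y) ^ 2) / n) := by
  have hn' : (0 : ℝ) < n := by exact_mod_cast hn
  have hlow : Real.exp (-(n * y)) * (1 - n * y ^ 2) ≤ (1 - y) ^ (n - τ) := by
    have h1 : Real.exp (-(n * y)) * (1 - n * y ^ 2) ≤ (1 - y) ^ n := by
      have hb : 1 + n * (-y ^ 2) ≤ (1 + -y ^ 2) ^ n :=
        one_add_mul_le_pow (by nlinarith) n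
      have he : (Real.exp (-y)) ^ n = Real.exp (-(n * y)) := by
        rw [← Real.exp_nat_mul]; ring_nf
      calc Real.exp (-(n * y)) * (1 - n * y ^ 2) ≤ Real.exp (-y) ^ n * (1 + -y ^ 2) ^ n := by
            rw [he]
            gcongr
            linarith
        _ = (Real.exp (-y) * (1 + y) * (1 - y)) ^ n := by rw [← mul_pow]; ring_nf
        _ ≤ (1 * (1 - y)) ^ n := by
            have : Real.exp (-y) * (1 + y) ≤ 1 := by
              rw [Real.exp_neg, inv_mul_le_iff₀ (Real.exp_pos y)]
              linarith [Real.add_one_le_exp y]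
            have h0 : 0 ≤ 1 - y := by linarith
            gcongr
        _ = (1 - y) ^ n := by rw [one_mul]
    exact h1.trans (pow_le_pow_of_le_one (by linarith) (by linarith) (Nat.sub_le _ _))
  have hup : (1 - y) ^ (n - τ) ≤ Real.exp (-(n * y)) * (1 + τ * y * Real.exp τ) := by
    have h1 : (1 - y) ^ (n - τ) ≤ Real.exp (-(n * y)) * Real.exp (τ * y) := by
      calc (1 - y) ^ (n - τ) ≤ Real.exp (-y) ^ (n - τ) := by
            have := Real.add_one_le_exp (-y)
            exact pow_le_pow_left₀ (by linarith) (by linarith) _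
        _ = Real.exp (-(n * y)) * Real.exp (τ * y) := by
            rw [← Real.exp_nat_mul, ← Real.exp_add, Nat.cast_sub hτ]
            ring_nf
    refine h1.trans ?_
    gcongr
    -- Multiplying 1 - z ≤ e^(-z) by e^z gives e^z ≤ 1 + z e^z, used with z = τy ≤ τ.
    have h2 := Real.add_one_le_exp (-(τ * y))
    have h3 : Real.exp (τ * y) ≤ Real.exp τ := by
      gcongr
      have : (0 : ℝ) ≤ τ := by positivity
      nlinarith
    have h4 : Real.exp (τ * y) * Real.exp (-(τ * y)) = 1 := by
      rw [← Real.exp_add]; simp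
    have h5 : (0 : ℝ) ≤ τ * y := by positivity
    have h6 := mul_le_mul_of_nonneg_left h2 (Real.exp_pos (τ * y)).le
    nlinarith
  have e1 : (τ * Real.exp τ * (n * y) + (n * y) ^ 2) / n = τ * y * Real.exp τ + n * y ^ 2 := by
    field_simp
  have hE := Real.exp_pos (-(n * y))
  rw [e1, abs_le]
  have h5 : 0 ≤ Real.exp (-(n * y)) * (τ * y * Real.exp τ) := by positivity
  have h6 : 0 ≤ Real.exp (-(n * y)) * (n * y ^ 2) := by positivity
  constructor <;> nlinarith

lemma tendsto_choose_div_pow (τ : ℕ) :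
    Tendsto (fun n : ℕ => (n.choose τ : ℝ) / n ^ τ) atTop (𝓝 (1 / τ.factorial)) := by
  have h := isEquivalent_choose τ
  have h2 : (fun n : ℕ => (n.choose τ : ℝ) / n ^ τ) ~[atTop]
      fun n : ℕ => (n ^ τ / τ.factorial : ℝ) / n ^ τ := h.div .refl
  refine h2.symm.tendsto_nhds ?_
  refine tendsto_const_nhds.congr' ?_
  filter_upwards [eventually_gt_atTop 0] with n hn
  field_simp

/-- The binomial weights are uniformly approximated by the Poisson weights. -/
lemma exists_binomial_sub_poissonWeight_le {τ : ℕ} (hτ : 2 ≤ τ) :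
    ∃ ε : ℕ → ℝ, Tendsto ε atTop (𝓝 0) ∧ ∀ᶠ n : ℕ in atTop, ∀ y : ℝ, 0 ≤ y → y ≤ 1 →
      |n.choose τ * y ^ τ * (1 - y) ^ (n - τ) - poissonWeight τ (n * y)| ≤
        ε n * envelope (n * y) := by
  set c : ℕ → ℝ := fun n => (n.choose τ : ℝ) / n ^ τ with hc
  have hct := tendsto_choose_div_pow τ
  -- `A` collects the envelope constants of the powers τ+1 and τ+2 in the error of (1 - y)^(n-τ).
  set A : ℝ := Real.exp 1 * (τ + 1).factorial * (τ * Real.exp τ) +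
    Real.exp 1 * (τ + 2).factorial with hA
  refine ⟨fun n => c n * (A / n) + |c n - 1 / τ.factorial| * (Real.exp 1 * τ.factorial), ?_, ?_⟩
  · have h1 : Tendsto (fun n : ℕ => A / (n : ℝ)) atTop (𝓝 0) :=
      tendsto_const_div_atTop_nhds_zero_nat A
    have h2 : Tendsto (fun n => |c n - 1 / τ.factorial|) atTop (𝓝 0) := by
      have := (hct.sub_const (1 / (τ.factorial : ℝ))).abs
      simpa using this
    have := (hct.mul h1).add (h2.mul_const (Real.exp 1 * τ.factorial))
    simpa using this
  · filter_upwards [eventually_ge_atTop τ] with n hn y hy hy1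
    have hn0 : 0 < n := by omega
    have hn' : (0 : ℝ) < n := by exact_mod_cast hn0
    set x : ℝ := n * y with hx
    have hx0 : 0 ≤ x := by positivity
    have hcn : 0 ≤ c n := by positivity
    have e1 : (n.choose τ : ℝ) * y ^ τ = c n * x ^ τ := by
      rw [hc, hx, mul_pow]
      field_simp
    have hb := abs_one_sub_pow_sub_exp_le hn0 hn hy hy1
    rw [← hx] at hb
    have e2 : n.choose τ * y ^ τ * (1 - y) ^ (n - τ) - poissonWeight τ x =
        c n * x ^ τ * ((1 - y) ^ (n - τ) - Real.exp (-x)) +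
          (c n - 1 / τ.factorial) * (x ^ τ * Real.exp (-x)) := by
      rw [e1, poissonWeight]
      ring
    rw [e2]
    refine (abs_add_le _ _).trans ?_
    rw [abs_mul (c n * x ^ τ), abs_mul (c n - _), abs_of_nonneg (by positivity : 0 ≤ c n * x ^ τ),
      abs_of_nonneg (by positivity : 0 ≤ x ^ τ * Real.exp (-x)), add_mul]
    refine add_le_add ?_ ?_
    · calc c n * x ^ τ * |(1 - y) ^ (n - τ) - Real.exp (-x)|
          ≤ c n * x ^ τ * (Real.exp (-x) * ((τ * Real.exp τ * x + x ^ 2) / n)) := by gcongr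
        _ = c n * ((τ * Real.exp τ * (x ^ (τ + 1) * Real.exp (-x)) +
              x ^ (τ + 2) * Real.exp (-x)) / n) := by ring
        _ ≤ c n * ((τ * Real.exp τ * (Real.exp 1 * (τ + 1).factorial * envelope x) +
              Real.exp 1 * (τ + 2).factorial * envelope x) / n) := by
            gcongr c n * ((τ * Real.exp τ * ?_ + ?_) / n)
            · exact pow_mul_exp_neg_le_envelope (by omega) hx0
            · exact pow_mul_exp_neg_le_envelope (by omega) hx0
        _ = c n * (A / n) * envelope x := by rw [hA]; ring
    · rw [mul_assoc]
      exact mul_le_mul_of_nonneg_left (pow_mul_exp_neg_le_envelope hτ hx0) (abs_nonneg _)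

/-! ### Renewal theory for finitely supported laws -/

section Renewal

variable {ι : Type*} [Fintype ι] {p s : ι → ℝ}

lemma tendsto_sub_const_atTop (c : ℝ) : Tendsto (fun t : ℝ => t - c) atTop atTop :=
  tendsto_atTop_add_const_right _ (-c) tendsto_id

lemma tendsto_sub_const_atBot (c : ℝ) : Tendsto (fun t : ℝ => t - c) atBot atBot :=
  tendsto_atBot_add_const_right _ (-c) tendsto_id

/-- If `D` is asymptotically harmonic and asymptotically bounded above by `L`, then convergence of
`D` to `L` along a filter propagates to the translates of `D`. -/
lemma tendsto_translate_of_tendsto (hp : ∀ i, 0 < p i) (hp1 : ∑ i, p i = 1) {D : ℝ → ℝ} {L : ℝ}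
    (hD : ∀ ε > 0, ∀ᶠ t in atTop, D t < L + ε)
    (hr : Tendsto (fun t => D t - ∑ i, p i * D (t - s i)) atTop (𝓝 0))
    {l : Filter ℝ} (hl : l ≤ atTop) (hlim : Tendsto D l (𝓝 L)) (j : ι) :
    Tendsto (fun t => D (t - s j)) l (𝓝 L) := by
  rw [Metric.tendsto_nhds]
  intro ε hε
  have hpj := hp j
  have hpj1 : p j ≤ 1 := by
    rw [← hp1]
    exact Finset.single_le_sum (fun i _ => (hp i).le) (Finset.mem_univ j)
  set δ := ε * p j / 2 with hδ
  have hδ0 : 0 < δ := by positivity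
  have h1 : ∀ᶠ t in l, ∀ i, D (t - s i) < L + δ :=
    eventually_all.2 fun i => hl ((tendsto_sub_const_atTop (s i)).eventually (hD δ hδ0))
  have h2 : Tendsto (fun t => L - D t + (D t - ∑ i, p i * D (t - s i))) l (𝓝 (L - L + 0)) :=
    (tendsto_const_nhds.sub hlim).add (hr.mono_left hl)
  rw [sub_self, zero_add] at h2
  filter_upwards [h1, h2.eventually_lt_const hδ0] with t ht1 ht2
  -- An average close to the upper bound forces every term close to it: the summands on the right
  -- are nonnegative with small total.
  have e : L - D t + (D t - ∑ i, p i * D (t - s i)) + δ = ∑ i, p i * (L + δ - D (t - s i)) := by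
    simp_rw [mul_sub]
    rw [Finset.sum_sub_distrib, ← Finset.sum_mul, hp1]
    ring
  have h3 : p j * (L + δ - D (t - s j)) ≤ ∑ i, p i * (L + δ - D (t - s i)) :=
    Finset.single_le_sum (f := fun i => p i * (L + δ - D (t - s i)))
      (fun i _ => mul_nonneg (hp i).le (by linarith [ht1 i])) (Finset.mem_univ j)
  have h4 : p j * (L + δ - D (t - s j)) < p j * ε := by
    calc _ ≤ _ := h3
      _ < δ + δ := by rw [← e]; linarith
      _ = p j * ε := by rw [hδ]; ring
  have h5 := lt_of_mul_lt_mul_left h4 hpj.le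
  have h6 : δ < ε := by rw [hδ]; nlinarith
  rw [Real.dist_eq, abs_lt]
  constructor <;> linarith [ht1 j]

/-- Let `L` be the limsup of the increment `D`, attained along an ultrafilter. `D` is again
asymptotically harmonic, so its translates by all multiples of the step also tend to `L` there.
Summing `K` of them telescopes to a difference of values of `G`, so `K * L ≤ 2 * M` for all `K`,
which forces `L ≤ 0`. -/
lemma eventually_sub_translate_lt (hp : ∀ i, 0 < p i) (hp1 : ∑ i, p i = 1) {G : ℝ → ℝ} {M : ℝ}
    (hG : ∀ t, |G t| ≤ M)
    (hr : Tendsto (fun t => G t - ∑ i, p i * G (t - s i)) atTop (𝓝 0)) (j : ι) {ε : ℝ}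
    (hε : 0 < ε) : ∀ᶠ t in atTop, G t - G (t - s j) < ε := by
  set D : ℝ → ℝ := fun t => G t - G (t - s j) with hD
  have hDM : ∀ t, |D t| ≤ 2 * M := fun t => by
    have := abs_sub (G t) (G (t - s j))
    linarith [hG t, hG (t - s j)]
  have hbdd : IsBoundedUnder (· ≤ ·) atTop D :=
    isBoundedUnder_of ⟨2 * M, fun t => (abs_le.1 (hDM t)).2⟩
  have hcobdd : IsCoboundedUnder (· ≤ ·) atTop D :=
    (isBoundedUnder_of ⟨-(2 * M), fun t => (abs_le.1 (hDM t)).1⟩ :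
      IsBoundedUnder (· ≥ ·) atTop D).isCoboundedUnder_le
  set L := limsup D atTop with hL
  have hup : ∀ ε > 0, ∀ᶠ t in atTop, D t < L + ε := fun ε hε =>
    eventually_lt_of_limsup_lt (by linarith) hbdd
  have hfreq : ∀ ε > 0, ∃ᶠ t in atTop, L - ε < D t := fun ε hε =>
    frequently_lt_of_lt_limsup hcobdd (by linarith)
  have hclus : MapClusterPt L atTop D := by
    rw [mapClusterPt_iff_frequently]
    intro S hS
    obtain ⟨ε, hε, hball⟩ := Metric.mem_nhds_iff.1 hS
    refine ((hfreq ε hε).and_eventually (hup ε hε)).mono fun t ht => hball ?_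
    rw [Metric.mem_ball, Real.dist_eq, abs_lt]
    constructor <;> linarith [ht.1, ht.2]
  obtain ⟨U, hU, hUL⟩ := mapClusterPt_iff_ultrafilter.1 hclus
  have hDr : Tendsto (fun t => D t - ∑ i, p i * D (t - s i)) atTop (𝓝 0) := by
    have := hr.sub (hr.comp (tendsto_sub_const_atTop (s j)))
    rw [sub_zero] at this
    refine this.congr fun t => ?_
    simp only [hD, Function.comp_apply, mul_sub, Finset.sum_sub_distrib]
    have : ∀ i, t - s j - s i = t - s i - s j := fun i => by ring
    simp_rw [this]
    ring
  have hk : ∀ k : ℕ, Tendsto (fun t => D (t - k * s j)) U (𝓝 L) := by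
    intro k
    induction k with
    | zero => simpa using hUL
    | succ k ih =>
      have hle : map (fun t => t - k * s j) (U : Filter ℝ) ≤ atTop :=
        (tendsto_sub_const_atTop (k * s j)).mono_left hU
      have := tendsto_translate_of_tendsto hp hp1 hup hDr hle (tendsto_map'_iff.2 ih) j
      refine (tendsto_map'_iff.1 this).congr fun t => ?_
      simp only [Function.comp_apply]
      congr 1
      push_cast
      ring
  have hsum : ∀ K : ℕ, (K : ℝ) * L ≤ 2 * M := by
    intro K
    have h1 : Tendsto (fun t => ∑ k ∈ Finset.range K, D (t - k * s j)) U (𝓝 (K * L)) := by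
      have := tendsto_finsetSum (Finset.range K) fun k _ => hk k
      simpa using this
    refine le_of_tendsto h1 (Eventually.of_forall fun t => ?_)
    have e : ∑ k ∈ Finset.range K, D (t - k * s j) = G t - G (t - K * s j) := by
      have := Finset.sum_range_sub' (fun k : ℕ => G (t - k * s j)) K
      simp only [Nat.cast_zero, zero_mul, sub_zero] at this
      rw [← this]
      refine Finset.sum_congr rfl fun k _ => ?_
      simp only [hD]
      push_cast
      ring_nf
    rw [e]
    have := abs_sub (G t) (G (t - K * s j))
    linarith [hG t, hG (t - K * s j), le_abs_self (G t - G (t - K * s j))]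
  have hL0 : L ≤ 0 := by
    by_contra h
    push Not at h
    obtain ⟨K, hK⟩ := exists_nat_gt (2 * M / L)
    rw [div_lt_iff₀ h] at hK
    linarith [hsum K]
  exact eventually_lt_of_limsup_lt (lt_of_le_of_lt hL0 hε) hbdd

/-- A bounded asymptotically harmonic function is asymptotically invariant under the steps. -/
lemma tendsto_sub_translate (hp : ∀ i, 0 < p i) (hp1 : ∑ i, p i = 1) {G : ℝ → ℝ} {M : ℝ}
    (hG : ∀ t, |G t| ≤ M)
    (hr : Tendsto (fun t => G t - ∑ i, p i * G (t - s i)) atTop (𝓝 0)) (j : ι) :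
    Tendsto (fun t => G t - G (t - s j)) atTop (𝓝 0) := by
  rw [Metric.tendsto_nhds]
  intro ε hε
  have h1 := eventually_sub_translate_lt hp hp1 hG hr j hε
  have hr' : Tendsto (fun t => -G t - ∑ i, p i * -G (t - s i)) atTop (𝓝 0) := by
    have := hr.neg
    rw [neg_zero] at this
    refine this.congr fun t => ?_
    simp only [mul_neg, Finset.sum_neg_distrib]
    ring
  have h2 := eventually_sub_translate_lt (G := fun t => -G t) hp hp1
    (fun t => by rw [abs_neg]; exact hG t) hr' j hε
  filter_upwards [h1, h2] with t ht1 ht2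
  rw [Real.dist_eq, sub_zero, abs_lt]
  constructor <;> linarith

/-- The group of asymptotic periods of `G` at infinity. -/
def asymptoticPeriods (G : ℝ → ℝ) : AddSubgroup ℝ where
  carrier := {u | Tendsto (fun t => G t - G (t - u)) atTop (𝓝 0)}
  zero_mem' := by simp
  add_mem' {u v} hu hv := by
    have := Tendsto.add hu (Tendsto.comp hv (tendsto_sub_const_atTop u))
    rw [add_zero] at this
    refine this.congr fun t => ?_
    simp only [Function.comp_apply, sub_sub]
    ring
  neg_mem' {u} hu := by
    have := (Tendsto.comp hu (tendsto_sub_const_atTop (-u))).neg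
    rw [neg_zero] at this
    refine this.congr fun t => ?_
    simp

lemma mem_asymptoticPeriods {G : ℝ → ℝ} {u : ℝ} :
    u ∈ asymptoticPeriods G ↔ Tendsto (fun t => G t - G (t - u)) atTop (𝓝 0) := Iff.rfl

lemma closure_le_asymptoticPeriods (hp : ∀ i, 0 < p i) (hp1 : ∑ i, p i = 1) {G φ : ℝ → ℝ} {M : ℝ}
    (hG : ∀ t, |G t| ≤ M) (hren : ∀ t, G t = φ t + ∑ i, p i * G (t - s i))
    (hφ : Tendsto φ atTop (𝓝 0)) :
    AddSubgroup.closure (Set.range s) ≤ asymptoticPeriods G := by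
  rw [AddSubgroup.closure_le]
  rintro _ ⟨j, rfl⟩
  refine tendsto_sub_translate hp hp1 hG (hφ.congr fun t => ?_) j
  rw [hren t]
  ring

/-- The renewal theorem in the lattice case. -/
theorem renewal_lattice (hp : ∀ i, 0 < p i) (hp1 : ∑ i, p i = 1) {G φ : ℝ → ℝ} {M : ℝ}
    (hG : ∀ t, |G t| ≤ M) (hren : ∀ t, G t = φ t + ∑ i, p i * G (t - s i))
    (hφ : Tendsto φ atTop (𝓝 0)) (hbot : Tendsto G atBot (𝓝 0)) {d : ℝ} (hd : 0 < d)
    {N : ι → ℕ} (hN : ∀ i, s i = N i * d) (hcl : d ∈ AddSubgroup.closure (Set.range s))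
    (hsum : ∀ t, Summable fun n : ℕ => φ (t - n * d)) :
    Tendsto (fun t => G t * (∑ i, p i * s i) - d * ∑' n : ℕ, φ (t - n * d)) atTop (𝓝 0) := by
  have hper : ∀ k : ℕ, Tendsto (fun t => G t - G (t - k * d)) atTop (𝓝 0) := fun k => by
    have h := (asymptoticPeriods G).nsmul_mem (closure_le_asymptoticPeriods hp hp1 hG hren hφ hcl) k
    rw [nsmul_eq_mul] at h
    exact h
  -- The renewal equation telescopes to B(t) - B(t - d) = φ(t), and B vanishes at -∞, so B is the
  -- sum of φ over t - nd. Asymptotic d-periodicity gives dB(t) ≈ G(t) ∑ p_i s_i.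
  set B : ℝ → ℝ := fun t => ∑ i, p i * ∑ k ∈ Finset.range (N i), G (t - k * d) with hB
  have hstep : ∀ t, B t - B (t - d) = φ t := by
    intro t
    simp only [hB]
    rw [← Finset.sum_sub_distrib]
    have : ∀ i, p i * ∑ k ∈ Finset.range (N i), G (t - k * d) -
        p i * ∑ k ∈ Finset.range (N i), G (t - d - k * d) = p i * G t - p i * G (t - s i) := by
      intro i
      rw [← mul_sub, ← mul_sub, ← Finset.sum_sub_distrib, hN]
      have := Finset.sum_range_sub' (fun k : ℕ => G (t - k * d)) (N i)
      simp only [Nat.cast_zero, zero_mul, sub_zero] at this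
      rw [← this]
      congr 1
      refine Finset.sum_congr rfl fun k _ => ?_
      push_cast
      ring_nf
    simp_rw [this]
    rw [Finset.sum_sub_distrib, ← Finset.sum_mul, hp1, hren t]
    ring
  have hBbot : Tendsto B atBot (𝓝 0) := by
    have : Tendsto B atBot (𝓝 (∑ i, p i * ∑ k ∈ Finset.range (N i), (0 : ℝ))) :=
      tendsto_finsetSum _ fun i _ => Tendsto.const_mul _ <|
        tendsto_finsetSum _ fun (k : ℕ) _ => hbot.comp (tendsto_sub_const_atBot (k * d))
    simpa using this
  have hBsum : ∀ t, B t = ∑' n : ℕ, φ (t - n * d) := by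
    intro t
    refine tendsto_nhds_unique ?_ (hsum t).hasSum.tendsto_sum_nat
    have h1 : Tendsto (fun K : ℕ => t - K * d) atTop atBot := by
      refine tendsto_atBot_add_const_left _ t (tendsto_neg_atTop_atBot.comp ?_)
      exact tendsto_natCast_atTop_atTop.atTop_mul_const hd
    have h2 := (hBbot.comp h1).const_sub (B t)
    rw [sub_zero] at h2
    refine h2.congr fun K => ?_
    have := Finset.sum_range_sub' (fun k : ℕ => B (t - k * d)) K
    simp only [Nat.cast_zero, zero_mul, sub_zero] at this
    simp only [Function.comp_apply]
    rw [← this]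
    refine Finset.sum_congr rfl fun k _ => ?_
    rw [← hstep]
    push_cast
    ring_nf
  simp_rw [← hBsum]
  have hlim : Tendsto (fun t => ∑ i, p i * (d * ∑ k ∈ Finset.range (N i), (G t - G (t - k * d))))
      atTop (𝓝 (∑ i, p i * (d * ∑ k ∈ Finset.range (N i), (0 : ℝ)))) :=
    tendsto_finsetSum _ fun i _ => ((tendsto_finsetSum _ fun k _ => hper k).const_mul _).const_mul _
  simp only [Finset.sum_const_zero, mul_zero] at hlim
  refine hlim.congr fun t => ?_
  simp only [hB]
  rw [Finset.mul_sum, Finset.mul_sum, ← Finset.sum_sub_distrib]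
  refine Finset.sum_congr rfl fun i _ => ?_
  rw [Finset.sum_sub_distrib, Finset.sum_const, Finset.card_range, nsmul_eq_mul, hN]
  ring

/-- The one-sided growth bound replaces uniform continuity: `G (t - u)` is squeezed between the
values at two asymptotic periods `g < u < g'` near `u`. -/
lemma asymptoticPeriods_eq_top {G : ℝ → ℝ} {M c : ℝ} (hG0 : ∀ t, 0 ≤ G t) (hG : ∀ t, G t ≤ M)
    (hc : 0 ≤ c) (hmono : ∀ t u, 0 ≤ u → G (t + u) ≤ Real.exp (c * u) * G t)
    (hdense : Dense (asymptoticPeriods G : Set ℝ)) (u : ℝ) : u ∈ asymptoticPeriods G := by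
  rw [mem_asymptoticPeriods, Metric.tendsto_nhds]
  intro ε hε
  obtain ⟨δ, hδ, hδε⟩ : ∃ δ > 0, (Real.exp (c * δ) - 1) * M < ε / 2 := by
    have h : Tendsto (fun δ : ℝ => (Real.exp (c * δ) - 1) * M) (𝓝[>] 0) (𝓝 0) := by
      have : Continuous fun δ : ℝ => (Real.exp (c * δ) - 1) * M := by fun_prop
      have := this.tendsto 0
      simp only [mul_zero, Real.exp_zero, sub_self, zero_mul] at this
      exact this.mono_left nhdsWithin_le_nhds
    obtain ⟨δ, h1, h2⟩ := ((h.eventually_lt_const (half_pos hε)).and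
      self_mem_nhdsWithin).exists
    exact ⟨δ, h2, h1⟩
  have hsmall : ∀ t v, 0 ≤ v → v ≤ δ → G (t + v) ≤ G t + ε / 2 := by
    intro t v hv hvδ
    have h1 := hmono t v hv
    have h2 : Real.exp (c * v) ≤ Real.exp (c * δ) := by gcongr
    have h3 : 1 ≤ Real.exp (c * δ) := Real.one_le_exp (by positivity)
    nlinarith [hG0 t, hG t]
  obtain ⟨g, hg, hg1, hg2⟩ := hdense.exists_between (show u - δ < u by linarith)
  obtain ⟨g', hg', hg1', hg2'⟩ := hdense.exists_between (show u < u + δ by linarith)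
  rw [SetLike.mem_coe, mem_asymptoticPeriods] at hg hg'
  filter_upwards [hg.eventually_lt_const (half_pos hε),
    hg'.eventually_const_lt (neg_lt_zero.2 (half_pos hε))] with t ht ht'
  have h1 := hsmall (t - u) (u - g) (by linarith) (by linarith)
  have h2 := hsmall (t - g') (g' - u) (by linarith) (by linarith)
  rw [show t - u + (u - g) = t - g by ring] at h1
  rw [show t - g' + (g' - u) = t - u by ring] at h2
  rw [Real.dist_eq, sub_zero, abs_lt]
  constructor <;> linarith

/-- The renewal theorem in the nonlattice case. -/
theorem renewal_nonlattice (hp : ∀ i, 0 < p i) (hp1 : ∑ i, p i = 1) {G φ Φ : ℝ → ℝ} {M c I : ℝ}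
    (hG0 : ∀ t, 0 ≤ G t) (hG : ∀ t, G t ≤ M) (hcont : Continuous G)
    (hren : ∀ t, G t = φ t + ∑ i, p i * G (t - s i))
    (hφ : Tendsto φ atTop (𝓝 0)) (hbot : Tendsto G atBot (𝓝 0))
    (hc : 0 ≤ c) (hmono : ∀ t u, 0 ≤ u → G (t + u) ≤ Real.exp (c * u) * G t)
    (hdense : Dense (AddSubgroup.closure (Set.range s) : Set ℝ))
    (hΦ : ∀ t, HasDerivAt Φ (φ t) t) (hΦbot : Tendsto Φ atBot (𝓝 0))
    (hΦtop : Tendsto Φ atTop (𝓝 I)) :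
    Tendsto (fun t => G t * ∑ i, p i * s i) atTop (𝓝 I) := by
  have habs : ∀ t, |G t| ≤ M := fun t => by rw [abs_of_nonneg (hG0 t)]; exact hG t
  have hper : ∀ u, Tendsto (fun t => G t - G (t - u)) atTop (𝓝 0) :=
    asymptoticPeriods_eq_top hG0 hG hc hmono
      (hdense.mono (closure_le_asymptoticPeriods hp hp1 habs hren hφ))
  set V : ℝ → ℝ := fun t => ∫ u in (0 : ℝ)..t, G u with hV
  have hVd : ∀ t, HasDerivAt V (G t) t := fun t =>
    intervalIntegral.integral_hasDerivAt_right (hcont.intervalIntegrable _ _)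
      hcont.stronglyMeasurable.stronglyMeasurableAtFilter hcont.continuousAt
  -- Averaged integral of `G` over a step back from `t`. By the renewal equation its derivative is
  -- φ, so it equals Φ; asymptotic invariance makes it close to G(t) times the mean step.
  set A : ℝ → ℝ := fun t => ∑ i, p i * (V t - V (t - s i)) with hA
  have hAd : ∀ t, HasDerivAt A (φ t) t := by
    intro t
    have h1 : HasDerivAt A (∑ i, p i * (G t - G (t - s i))) t :=
      HasDerivAt.fun_sum fun i _ => ((hVd t).sub ((hVd (t - s i)).comp_sub_const t (s i))).const_mul _
    convert h1 using 1
    simp_rw [mul_sub]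
    rw [Finset.sum_sub_distrib, ← Finset.sum_mul, hp1, hren t]
    ring
  have hAint : ∀ i t, V t - V (t - s i) = ∫ u in (0 : ℝ)..s i, G (t - u) := by
    intro i t
    rw [intervalIntegral.integral_comp_sub_left (fun u => G u) t, sub_zero]
    exact intervalIntegral.integral_interval_sub_left (hcont.intervalIntegrable _ _)
      (hcont.intervalIntegrable _ _)
  have hAbot : Tendsto A atBot (𝓝 0) := by
    have h : ∀ i, Tendsto (fun t => V t - V (t - s i)) atBot (𝓝 0) := by
      intro i
      simp_rw [hAint]
      have := intervalIntegral.tendsto_integral_filter_of_dominated_convergence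
        (μ := volume) (a := 0) (b := s i) (l := atBot) (F := fun (t u : ℝ) => G (t - u))
        (f := fun _ => (0 : ℝ)) (fun _ => M)
        (Eventually.of_forall fun t => (by fun_prop : Continuous fun u => G (t - u)).aestronglyMeasurable)
        (Eventually.of_forall fun t => Eventually.of_forall fun u _ => habs _)
        intervalIntegrable_const
        (Eventually.of_forall fun u _ => hbot.comp (tendsto_sub_const_atBot u))
      simpa using this
    have : Tendsto A atBot (𝓝 (∑ i, p i * (0 : ℝ))) :=
      tendsto_finsetSum _ fun i _ => (h i).const_mul _
    simpa using this
  have hAΦ : ∀ t, A t = Φ t := by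
    have hconst : ∀ x y, (A - Φ) x = (A - Φ) y :=
      is_const_of_deriv_eq_zero (fun t => ((hAd t).sub (hΦ t)).differentiableAt)
        (fun t => by rw [((hAd t).sub (hΦ t)).deriv, sub_self])
    intro t
    have h1 : Tendsto (A - Φ) atBot (𝓝 ((A - Φ) t)) :=
      tendsto_const_nhds.congr fun x => hconst t x
    have h2 : Tendsto (A - Φ) atBot (𝓝 0) := by
      have := hAbot.sub hΦbot
      rwa [sub_zero] at this
    exact sub_eq_zero.1 (tendsto_nhds_unique h1 h2)
  have hdiff : Tendsto (fun t => ∑ i, p i * ∫ u in (0 : ℝ)..s i, (G t - G (t - u))) atTop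
      (𝓝 0) := by
    have h : ∀ i, Tendsto (fun t => ∫ u in (0 : ℝ)..s i, (G t - G (t - u))) atTop (𝓝 0) := by
      intro i
      have := intervalIntegral.tendsto_integral_filter_of_dominated_convergence
        (μ := volume) (a := 0) (b := s i) (l := atTop) (F := fun (t u : ℝ) => G t - G (t - u))
        (f := fun _ => (0 : ℝ)) (fun _ => M + M)
        (Eventually.of_forall fun t =>
          (by fun_prop : Continuous fun u => G t - G (t - u)).aestronglyMeasurable)
        (Eventually.of_forall fun t => Eventually.of_forall fun u _ =>
          (norm_sub_le _ _).trans (add_le_add (habs _) (habs _)))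
        intervalIntegrable_const
        (Eventually.of_forall fun u _ => hper u)
      simpa using this
    have : Tendsto (fun t => ∑ i, p i * ∫ u in (0 : ℝ)..s i, (G t - G (t - u))) atTop
        (𝓝 (∑ i, p i * (0 : ℝ))) := tendsto_finsetSum _ fun i _ => (h i).const_mul _
    simpa using this
  have := hdiff.add hΦtop
  rw [zero_add] at this
  refine this.congr fun t => ?_
  rw [← hAΦ t]
  simp only [hA]
  rw [← Finset.sum_add_distrib, Finset.mul_sum]
  refine Finset.sum_congr rfl fun i _ => ?_
  rw [hAint, intervalIntegral.integral_sub intervalIntegrable_const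
    ((by fun_prop : Continuous fun u => G (t - u)).intervalIntegrable _ _),
    intervalIntegral.integral_const, smul_eq_mul]
  ring

end Renewal

/-! ### The normalized Poisson weight -/

/-- The Poisson weight at `exp t`, divided by `exp t`. -/
def renewalWeight (τ : ℕ) (t : ℝ) : ℝ := Real.exp (-t) * poissonWeight τ (Real.exp t)

lemma renewalWeight_nonneg (τ : ℕ) (t : ℝ) : 0 ≤ renewalWeight τ t :=
  mul_nonneg (Real.exp_pos _).le (poissonWeight_nonneg τ (Real.exp_pos t).le)

lemma continuous_poissonWeight (τ : ℕ) : Continuous (poissonWeight τ) := by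
  unfold poissonWeight
  fun_prop

lemma continuous_renewalWeight (τ : ℕ) : Continuous (renewalWeight τ) := by
  have := continuous_poissonWeight τ
  unfold renewalWeight
  fun_prop

/-- The normalized envelope is e^t/(1 + e^t)², which decays exponentially on both sides. -/
lemma renewalWeight_le {τ : ℕ} (hτ : 2 ≤ τ) (t : ℝ) :
    renewalWeight τ t ≤ Real.exp 1 * Real.exp (-|t|) := by
  have hx := Real.exp_pos t
  have h1 := poissonWeight_le_envelope hτ hx.le
  have h2 : Real.exp (-t) * envelope (Real.exp t) ≤ Real.exp (-|t|) := by
    have h3 : Real.exp (-t) * envelope (Real.exp t) = Real.exp t / (1 + Real.exp t) ^ 2 := by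
      unfold envelope
      rw [Real.exp_neg]
      field_simp
    rw [h3, div_le_iff₀ (by positivity)]
    rcases abs_cases t with ⟨h, _⟩ | ⟨h, _⟩
    · rw [h, Real.exp_neg, ← div_eq_inv_mul, le_div_iff₀ hx]
      nlinarith
    · rw [h, neg_neg]
      exact le_mul_of_one_le_right hx.le (one_le_pow₀ (by linarith))
  calc renewalWeight τ t ≤ Real.exp (-t) * (Real.exp 1 * envelope (Real.exp t)) :=
        mul_le_mul_of_nonneg_left h1 (Real.exp_pos _).le
    _ = Real.exp 1 * (Real.exp (-t) * envelope (Real.exp t)) := by ring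
    _ ≤ _ := by gcongr

lemma tendsto_renewalWeight_atTop {τ : ℕ} (hτ : 2 ≤ τ) :
    Tendsto (renewalWeight τ) atTop (𝓝 0) := by
  refine squeeze_zero (renewalWeight_nonneg τ) (renewalWeight_le hτ) ?_
  have := (Real.tendsto_exp_neg_atTop_nhds_zero.comp tendsto_abs_atTop_atTop).const_mul
    (Real.exp 1)
  simpa using this

lemma hasDerivAt_exp_neg_mul_sum (j : ℕ) (x : ℝ) :
    HasDerivAt (fun x : ℝ => Real.exp (-x) * ∑ i ∈ Finset.range (j + 1), x ^ i / i.factorial)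
      (-(Real.exp (-x) * x ^ j / j.factorial)) x := by
  have he : HasDerivAt (fun x : ℝ => Real.exp (-x)) (-Real.exp (-x)) x := by
    simpa using (hasDerivAt_neg x).exp
  induction j with
  | zero => simpa using he
  | succ j ih =>
    have h1 : HasDerivAt (fun x : ℝ => Real.exp (-x) * (x ^ (j + 1) / (j + 1).factorial))
        (-Real.exp (-x) * (x ^ (j + 1) / (j + 1).factorial) +
          Real.exp (-x) * (((j + 1 : ℕ) * x ^ j) / (j + 1).factorial)) x :=
      he.mul ((hasDerivAt_pow (j + 1) x).div_const _)
    have h2 := ih.add h1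
    refine (h2.congr_deriv ?_).congr_of_eventuallyEq (Eventually.of_forall fun y => ?_)
    · rw [Nat.factorial_succ]
      push_cast
      field_simp
      ring
    · simp only [Pi.add_apply]
      rw [Finset.sum_range_succ _ (j + 1), mul_add]

/-- The normalized Poisson weight has an antiderivative that vanishes at `-∞` and tends to
`1 / (τ * (τ - 1))` at `∞`. -/
lemma exists_antiderivative_renewalWeight {τ : ℕ} (hτ : 2 ≤ τ) :
    ∃ Φ : ℝ → ℝ, (∀ t, HasDerivAt Φ (renewalWeight τ t) t) ∧ Tendsto Φ atBot (𝓝 0) ∧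
      Tendsto Φ atTop (𝓝 (1 / ((τ : ℝ) * ((τ : ℝ) - 1)))) := by
  obtain ⟨j, rfl⟩ := Nat.exists_eq_add_of_le' hτ
  -- With x = e^t and j = τ - 2, the weight integrates x^j e^(-x)/τ! dx; `1 - H` is the normalized
  -- incomplete gamma function, of total mass one.
  set H : ℝ → ℝ := fun x => Real.exp (-x) * ∑ i ∈ Finset.range (j + 1), x ^ i / i.factorial with hH
  have hc : (1 : ℝ) / (((j + 2 : ℕ) : ℝ) * (((j + 2 : ℕ) : ℝ) - 1)) =
      j.factorial / (j + 2).factorial := by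
    rw [Nat.factorial_succ, Nat.factorial_succ]
    push_cast
    have : (j : ℝ) + 2 - 1 ≠ 0 := by
      have := Nat.cast_nonneg (α := ℝ) j
      linarith
    field_simp
    ring
  refine ⟨fun t => j.factorial / (j + 2).factorial * (1 - H (Real.exp t)), fun t => ?_, ?_, ?_⟩
  · have h1 := ((hasDerivAt_exp_neg_mul_sum j (Real.exp t)).comp t (Real.hasDerivAt_exp t))
    have h2 := (h1.const_sub 1).const_mul ((j.factorial : ℝ) / (j + 2).factorial)
    refine h2.congr_deriv ?_
    unfold renewalWeight poissonWeight
    rw [Real.exp_neg t]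
    field_simp
    ring
  · have hcont : Continuous H := by
      simp only [hH]
      fun_prop
    have h0 : H 0 = 1 := by
      simp only [hH, neg_zero, Real.exp_zero, one_mul]
      rw [Finset.sum_range_succ']
      simp
    have := ((hcont.tendsto 0).comp Real.tendsto_exp_atBot).const_sub 1
    have := this.const_mul ((j.factorial : ℝ) / (j + 2).factorial)
    simpa [h0] using this
  · have hlim : Tendsto H atTop (𝓝 0) := by
      have : Tendsto (fun x : ℝ => ∑ i ∈ Finset.range (j + 1),
          x ^ i * Real.exp (-x) / i.factorial) atTop
          (𝓝 (∑ i ∈ Finset.range (j + 1), 0 / (i.factorial : ℝ))) :=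
        tendsto_finsetSum _ fun i _ =>
          (Real.tendsto_pow_mul_exp_neg_atTop_nhds_zero i).div_const _
      simp only [zero_div, Finset.sum_const_zero] at this
      refine this.congr fun x => ?_
      simp only [hH]
      rw [Finset.mul_sum]
      exact Finset.sum_congr rfl fun i _ => by ring
    have := ((hlim.comp Real.tendsto_exp_atTop).const_sub 1).const_mul
      ((j.factorial : ℝ) / (j + 2).factorial)
    rw [hc]
    simpa using this

/-! ### The Poissonized mean -/

/-- The sum of the Poisson weights over all words, normalized. -/
def renewalMean (p : Fin m → ℝ) (τ : ℕ) (t : ℝ) : ℝ :=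
  Real.exp (-t) * ∑' w, poissonWeight τ (Real.exp t * wordProb p w)

lemma summable_poissonWeight (hm : 2 ≤ m) (hp : ∀ j, 0 < p j) (hp1 : ∑ j, p j = 1) {τ : ℕ}
    (hτ : 2 ≤ τ) {x : ℝ} (hx : 0 ≤ x) : Summable fun w => poissonWeight τ (x * wordProb p w) := by
  obtain ⟨κ, -, h⟩ := exists_envelope_bound hm hp hp1
  have hxw : ∀ w, 0 ≤ x * wordProb p w := fun w => mul_nonneg hx (wordProb_pos hp w).le
  exact Summable.of_nonneg_of_le (fun w => poissonWeight_nonneg τ (hxw w))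
    (fun w => poissonWeight_le_envelope hτ (hxw w)) ((h x hx).1.mul_left _)

lemma renewalMean_nonneg (hp : ∀ j, 0 < p j) (τ : ℕ) (t : ℝ) : 0 ≤ renewalMean p τ t :=
  mul_nonneg (Real.exp_pos _).le (tsum_nonneg fun w => poissonWeight_nonneg τ
    (mul_nonneg (Real.exp_pos t).le (wordProb_pos hp w).le))

lemma exists_renewalMean_le (hm : 2 ≤ m) (hp : ∀ j, 0 < p j) (hp1 : ∑ j, p j = 1) {τ : ℕ}
    (hτ : 2 ≤ τ) : ∃ M : ℝ, 0 < M ∧ ∀ t, renewalMean p τ t ≤ M ∧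
      renewalMean p τ t ≤ M * Real.exp t := by
  obtain ⟨κ, hκ, h⟩ := exists_envelope_bound hm hp hp1
  refine ⟨Real.exp 1 * κ, by positivity, fun t => ?_⟩
  have hx := Real.exp_pos t
  have hxw : ∀ w, 0 ≤ Real.exp t * wordProb p w := fun w =>
    mul_nonneg hx.le (wordProb_pos hp w).le
  have h1 : ∑' w, poissonWeight τ (Real.exp t * wordProb p w) ≤
      Real.exp 1 * (κ * (Real.exp t ^ 2 / (1 + Real.exp t))) := by
    refine le_trans ?_ (mul_le_mul_of_nonneg_left (h _ hx.le).2 (Real.exp_pos 1).le)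
    rw [← tsum_mul_left]
    exact (summable_poissonWeight hm hp hp1 hτ hx.le).tsum_le_tsum
      (fun w => poissonWeight_le_envelope hτ (hxw w)) ((h _ hx.le).1.mul_left _)
  have h2 : renewalMean p τ t ≤ Real.exp 1 * κ * (Real.exp t / (1 + Real.exp t)) := by
    refine (mul_le_mul_of_nonneg_left h1 (Real.exp_pos (-t)).le).trans_eq ?_
    rw [Real.exp_neg]
    field_simp
  have hM : 0 < Real.exp 1 * κ := by positivity
  constructor
  · refine h2.trans (mul_le_of_le_one_right hM.le ?_)
    rw [div_le_one (by positivity)]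
    linarith
  · refine h2.trans (mul_le_mul_of_nonneg_left ?_ hM.le)
    exact div_le_self hx.le (by linarith)

lemma tendsto_renewalMean_atBot (hm : 2 ≤ m) (hp : ∀ j, 0 < p j) (hp1 : ∑ j, p j = 1) {τ : ℕ}
    (hτ : 2 ≤ τ) : Tendsto (renewalMean p τ) atBot (𝓝 0) := by
  obtain ⟨M, -, hM⟩ := exists_renewalMean_le hm hp hp1 hτ
  refine squeeze_zero (renewalMean_nonneg hp τ) (fun t => (hM t).2) ?_
  simpa using Real.tendsto_exp_atBot.const_mul M

lemma envelope_mono {x y : ℝ} (hx : 0 ≤ x) (hxy : x ≤ y) : envelope x ≤ envelope y := by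
  unfold envelope
  rw [← div_pow, ← div_pow]
  have : x / (1 + x) ≤ y / (1 + y) := by
    rw [div_le_div_iff₀ (by linarith) (by linarith)]
    nlinarith
  exact pow_le_pow_left₀ (div_nonneg hx (by linarith)) this 2

lemma continuous_renewalMean (hm : 2 ≤ m) (hp : ∀ j, 0 < p j) (hp1 : ∑ j, p j = 1) {τ : ℕ}
    (hτ : 2 ≤ τ) : Continuous (renewalMean p τ) := by
  obtain ⟨κ, -, h⟩ := exists_envelope_bound hm hp hp1
  refine (by fun_prop : Continuous fun t : ℝ => Real.exp (-t)).mul ?_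
  rw [continuous_iff_continuousAt]
  intro t₀
  refine ContinuousOn.continuousAt (s := Set.Iio (t₀ + 1)) ?_ (Iio_mem_nhds (by linarith))
  have := continuous_poissonWeight τ
  refine continuousOn_tsum (u := fun w =>
    Real.exp 1 * envelope (Real.exp (t₀ + 1) * wordProb p w)) (fun w => ?_)
    ((h _ (Real.exp_pos _).le).1.mul_left _) fun w t ht => ?_
  · exact Continuous.continuousOn (by fun_prop)
  · have hw := (wordProb_pos hp w).le
    have hx : 0 ≤ Real.exp t * wordProb p w := mul_nonneg (Real.exp_pos t).le hw
    rw [Real.norm_of_nonneg (poissonWeight_nonneg τ hx)]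
    refine (poissonWeight_le_envelope hτ hx).trans ?_
    refine mul_le_mul_of_nonneg_left (envelope_mono hx ?_) (Real.exp_pos 1).le
    have : t ≤ t₀ + 1 := (Set.mem_Iio.1 ht).le
    gcongr

/-- The power x^τ grows by e^(τu), the factor e^(-x) only decreases, and the normalization gains
e^(-u). This supplies the growth condition of `renewal_nonlattice`. -/
lemma renewalMean_add_le (hm : 2 ≤ m) (hp : ∀ j, 0 < p j) (hp1 : ∑ j, p j = 1) {τ : ℕ}
    (hτ : 2 ≤ τ) (t u : ℝ) (hu : 0 ≤ u) :
    renewalMean p τ (t + u) ≤ Real.exp (((τ : ℝ) - 1) * u) * renewalMean p τ t := by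
  have h1 : ∀ w, poissonWeight τ (Real.exp (t + u) * wordProb p w) ≤
      Real.exp (τ * u) * poissonWeight τ (Real.exp t * wordProb p w) := by
    intro w
    have hw := (wordProb_pos hp w).le
    have hx : 0 ≤ Real.exp t * wordProb p w := mul_nonneg (Real.exp_pos t).le hw
    have e : Real.exp (t + u) * wordProb p w = Real.exp u * (Real.exp t * wordProb p w) := by
      rw [Real.exp_add]; ring
    rw [e]
    generalize Real.exp t * wordProb p w = x at hx
    have h2 : x ≤ Real.exp u * x := le_mul_of_one_le_left hx (Real.one_le_exp hu)
    unfold poissonWeight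
    rw [mul_pow, ← Real.exp_nat_mul, mul_div_assoc', ← mul_assoc (Real.exp (τ * u))]
    have h3 : Real.exp (-(Real.exp u * x)) ≤ Real.exp (-x) :=
      Real.exp_le_exp.2 (neg_le_neg h2)
    exact div_le_div_of_nonneg_right (mul_le_mul_of_nonneg_left h3
      (mul_nonneg (Real.exp_pos _).le (pow_nonneg hx τ))) (Nat.cast_nonneg _)
  have h2 : ∑' w, poissonWeight τ (Real.exp (t + u) * wordProb p w) ≤
      Real.exp (τ * u) * ∑' w, poissonWeight τ (Real.exp t * wordProb p w) := by
    rw [← tsum_mul_left]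
    exact (summable_poissonWeight hm hp hp1 hτ (Real.exp_pos _).le).tsum_le_tsum h1
      ((summable_poissonWeight hm hp hp1 hτ (Real.exp_pos _).le).mul_left _)
  unfold renewalMean
  refine (mul_le_mul_of_nonneg_left h2 (Real.exp_pos _).le).trans_eq ?_
  rw [← mul_assoc, ← mul_assoc, ← Real.exp_add, ← Real.exp_add]
  ring_nf

/-- The renewal equation. -/
lemma renewalMean_eq (hm : 2 ≤ m) (hp : ∀ j, 0 < p j) (hp1 : ∑ j, p j = 1) {τ : ℕ}
    (hτ : 2 ≤ τ) (t : ℝ) :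
    renewalMean p τ t = renewalWeight τ t + ∑ j, p j * renewalMean p τ (t - -Real.log (p j)) := by
  unfold renewalMean renewalWeight
  rw [tsum_words_eq (summable_poissonWeight hm hp hp1 hτ (Real.exp_pos t).le), mul_add,
    wordProb_nil, mul_one, Finset.mul_sum]
  congr 1
  refine Finset.sum_congr rfl fun j _ => ?_
  rw [sub_neg_eq_add, neg_add, Real.exp_add, Real.exp_add, Real.exp_neg (Real.log _),
    Real.exp_log (hp j)]
  have := (hp j).ne'
  simp_rw [wordProb_cons, ← mul_assoc]
  field_simp

/-! ### De-Poissonization -/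

lemma summable_binomial (hm : 2 ≤ m) (hp : ∀ j, 0 < p j) (hp1 : ∑ j, p j = 1) {τ : ℕ}
    (hτ : 2 ≤ τ) (n : ℕ) : Summable fun w => (n.choose τ : ℝ) * wordProb p w ^ τ *
      (1 - wordProb p w) ^ (n - τ) := by
  obtain ⟨κ, -, h⟩ := exists_envelope_bound hm hp hp1
  refine Summable.of_nonneg_of_le (fun w => ?_) (fun w => ?_)
    ((h 1 zero_le_one).1.mul_left ((n.choose τ : ℝ) * 4))
  · have h0 := wordProb_pos hp w
    have : 0 ≤ 1 - wordProb p w := by linarith [wordProb_le_one hp hp1 w]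
    positivity
  · have h0 := wordProb_pos hp w
    have h1 := wordProb_le_one hp hp1 w
    rw [one_mul]
    set y := wordProb p w
    have h2 : y ^ τ ≤ y ^ 2 := pow_le_pow_of_le_one h0.le h1 hτ
    have h3 : (1 - y) ^ (n - τ) ≤ 1 := pow_le_one₀ (by linarith) (by linarith)
    have h4 : y ^ 2 ≤ 4 * envelope y := by
      unfold envelope
      rw [mul_div_assoc', le_div_iff₀ (by positivity)]
      have : (1 + y) ^ 2 ≤ 4 := by nlinarith
      nlinarith [sq_nonneg y]
    calc n.choose τ * y ^ τ * (1 - y) ^ (n - τ) ≤ n.choose τ * y ^ τ * 1 := by gcongr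
      _ ≤ n.choose τ * (4 * envelope y) := by
        rw [mul_one]
        gcongr
        exact h2.trans h4
      _ = _ := by ring

/-- The termwise errors sum to at most |ε_n|κn. -/
lemma tendsto_binomial_sub_renewalMean (hm : 2 ≤ m) (hp : ∀ j, 0 < p j) (hp1 : ∑ j, p j = 1)
    {τ : ℕ} (hτ : 2 ≤ τ) :
    Tendsto (fun n : ℕ => (∑' w, (n.choose τ : ℝ) * wordProb p w ^ τ *
      (1 - wordProb p w) ^ (n - τ)) / n - renewalMean p τ (Real.log n)) atTop (𝓝 0) := by
  obtain ⟨κ, hκ, h⟩ := exists_envelope_bound hm hp hp1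
  obtain ⟨ε, hε, hb⟩ := exists_binomial_sub_poissonWeight_le hτ
  have hlim : Tendsto (fun n => |ε n| * κ) atTop (𝓝 0) := by
    simpa using hε.abs.mul_const κ
  refine squeeze_zero_norm' ?_ hlim
  filter_upwards [hb, eventually_gt_atTop 0] with n hn hn0
  have hn' : (0 : ℝ) < n := by exact_mod_cast hn0
  have hsp := summable_poissonWeight hm hp hp1 hτ hn'.le
  have e : renewalMean p τ (Real.log n) = (∑' w, poissonWeight τ (n * wordProb p w)) / n := by
    unfold renewalMean
    rw [Real.exp_neg, Real.exp_log hn', inv_mul_eq_div]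
  rw [e, ← sub_div, ← (summable_binomial hm hp hp1 hτ n).tsum_sub hsp, norm_div,
    Real.norm_of_nonneg hn'.le, div_le_iff₀ hn']
  have hterm : ∀ w, ‖(n.choose τ : ℝ) * wordProb p w ^ τ * (1 - wordProb p w) ^ (n - τ) -
      poissonWeight τ (n * wordProb p w)‖ ≤ |ε n| * envelope (n * wordProb p w) := fun w =>
    (hn _ (wordProb_pos hp w).le (wordProb_le_one hp hp1 w)).trans
      (mul_le_mul_of_nonneg_right (le_abs_self _) (envelope_nonneg _))
  have hs := (h n hn'.le).1.mul_left |ε n|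
  refine (tsum_of_norm_bounded hs.hasSum hterm).trans ?_
  rw [tsum_mul_left, mul_assoc]
  refine mul_le_mul_of_nonneg_left ((h n hn'.le).2.trans ?_) (abs_nonneg _)
  refine mul_le_mul_of_nonneg_left ?_ hκ.le
  rw [div_le_iff₀ (by positivity)]
  nlinarith

/-! ### Periodization of the normalized Poisson weight -/

/-- The periodization of the normalized Poisson weight with period `d`. -/
def periodization (τ : ℕ) (d t : ℝ) : ℝ := ∑' k : ℤ, renewalWeight τ (t - k * d)

lemma summable_exp_neg_abs_mul {d : ℝ} (hd : 0 < d) :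
    Summable fun k : ℤ => Real.exp (-(|(k : ℝ)| * d)) := by
  have h : Summable fun n : ℕ => Real.exp (-(n * d)) := by
    have := Real.summable_exp_nat_mul_iff.2 (neg_lt_zero.2 hd)
    simpa using this
  refine Summable.of_nat_of_neg ?_ ?_ <;> simpa using h

lemma renewalWeight_sub_le {τ : ℕ} (hτ : 2 ≤ τ) {d : ℝ} (hd : 0 < d) {R t : ℝ} (ht : |t| ≤ R)
    (k : ℤ) : renewalWeight τ (t - k * d) ≤
      Real.exp 1 * Real.exp R * Real.exp (-(|(k : ℝ)| * d)) := by
  refine (renewalWeight_le hτ _).trans ?_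
  rw [mul_assoc, ← Real.exp_add R]
  gcongr
  have h1 := abs_sub_abs_le_abs_sub (k * d : ℝ) t
  rw [abs_mul, abs_of_pos hd, abs_sub_comm] at h1
  linarith

lemma summable_renewalWeight_int {τ : ℕ} (hτ : 2 ≤ τ) {d : ℝ} (hd : 0 < d) (t : ℝ) :
    Summable fun k : ℤ => renewalWeight τ (t - k * d) :=
  Summable.of_nonneg_of_le (fun _ => renewalWeight_nonneg τ _)
    (fun k => renewalWeight_sub_le hτ hd le_rfl k) ((summable_exp_neg_abs_mul hd).mul_left _)

lemma continuous_periodization {τ : ℕ} (hτ : 2 ≤ τ) {d : ℝ} (hd : 0 < d) :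
    Continuous (periodization τ d) := by
  rw [continuous_iff_continuousAt]
  intro t₀
  refine ContinuousOn.continuousAt (s := Metric.ball t₀ 1) ?_ (Metric.ball_mem_nhds _ one_pos)
  have := continuous_renewalWeight τ
  refine continuousOn_tsum (fun k => Continuous.continuousOn (by fun_prop))
    ((summable_exp_neg_abs_mul hd).mul_left (Real.exp 1 * Real.exp (|t₀| + 1))) fun k t ht => ?_
  rw [Real.norm_of_nonneg (renewalWeight_nonneg τ _)]
  refine renewalWeight_sub_le hτ hd ?_ k
  rw [Metric.mem_ball, Real.dist_eq] at ht
  linarith [abs_sub_abs_le_abs_sub t t₀]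

lemma periodic_periodization (τ : ℕ) (d : ℝ) : Function.Periodic (periodization τ d) d := by
  intro t
  unfold periodization
  rw [← (Equiv.addRight (1 : ℤ)).tsum_eq (fun k : ℤ => renewalWeight τ (t + d - k * d))]
  refine tsum_congr fun k => ?_
  congr 1
  simp only [Equiv.coe_addRight]
  push_cast
  ring

/-- The translates of one period tile the line, so the result is the total integral of the weight.
The sum over k ≥ 0 telescopes to Φ(d) and the sum over k < 0 to Φ(∞) - Φ(d). -/
lemma integral_periodization {τ : ℕ} (hτ : 2 ≤ τ) {d : ℝ} (hd : 0 < d) :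
    ∫ t in (0 : ℝ)..d, periodization τ d t = 1 / ((τ : ℝ) * ((τ : ℝ) - 1)) := by
  obtain ⟨Φ, hΦ, hbot, htop⟩ := exists_antiderivative_renewalWeight hτ
  have hcont := continuous_renewalWeight τ
  have hmono : Monotone Φ := monotone_of_deriv_nonneg (fun t => (hΦ t).differentiableAt)
    fun t => by rw [(hΦ t).deriv]; exact renewalWeight_nonneg τ t
  have h_integral : ∀ k : ℤ, ∫ t in (0 : ℝ)..d, renewalWeight τ (t - k * d) =
      Φ (d - k * d) - Φ (0 - k * d) := by
    intro k
    refine intervalIntegral.integral_eq_sub_of_hasDerivAt (f := fun t => Φ (t - k * d))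
      (fun t _ => (hΦ _).comp_sub_const t (k * d)) ?_
    exact (by fun_prop : Continuous fun t => renewalWeight τ (t - k * d)).intervalIntegrable _ _
  have h1 : HasSum (fun k : ℤ => ∫ t in (0 : ℝ)..d, renewalWeight τ (t - k * d))
      (∫ t in (0 : ℝ)..d, periodization τ d t) := by
    refine intervalIntegral.hasSum_integral_of_dominated_convergence
      (fun k _ => Real.exp 1 * Real.exp d * Real.exp (-(|(k : ℝ)| * d))) (fun k => ?_)
      (fun k => Eventually.of_forall fun t ht => ?_)
      (Eventually.of_forall fun t _ => (summable_exp_neg_abs_mul hd).mul_left _)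
      intervalIntegrable_const
      (Eventually.of_forall fun t _ => (summable_renewalWeight_int hτ hd t).hasSum)
    · exact (by fun_prop : Continuous fun t => renewalWeight τ (t - k * d)).aestronglyMeasurable
    · rw [Set.uIoc_of_le hd.le, Set.mem_Ioc] at ht
      rw [Real.norm_of_nonneg (renewalWeight_nonneg τ _)]
      exact renewalWeight_sub_le hτ hd (by rw [abs_of_pos ht.1]; exact ht.2) k
  have hnd : Tendsto (fun n : ℕ => (n : ℝ) * d) atTop atTop :=
    tendsto_natCast_atTop_atTop.atTop_mul_const hd
  have h2 : HasSum (fun n : ℕ => Φ (d - ((n : ℤ) : ℝ) * d) - Φ (0 - ((n : ℤ) : ℝ) * d)) (Φ d) := by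
    rw [hasSum_iff_tendsto_nat_of_nonneg fun n => sub_nonneg.2 (hmono (by linarith))]
    have hlim : Tendsto (fun n : ℕ => d - n * d) atTop atBot :=
      tendsto_atBot_add_const_left _ d (tendsto_neg_atTop_atBot.comp hnd)
    have := (hbot.comp hlim).const_sub (Φ d)
    rw [sub_zero] at this
    refine this.congr fun n => ?_
    have h := Finset.sum_range_sub' (fun k : ℕ => Φ (d - k * d)) n
    simp only [Nat.cast_zero, zero_mul, sub_zero] at h
    rw [Function.comp_apply, ← h]
    refine Finset.sum_congr rfl fun k _ => ?_
    push_cast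
    ring_nf
  have h3 : HasSum (fun n : ℕ => Φ (d - ((-((n : ℤ) + 1) : ℤ) : ℝ) * d) -
      Φ (0 - ((-((n : ℤ) + 1) : ℤ) : ℝ) * d)) (1 / ((τ : ℝ) * ((τ : ℝ) - 1)) - Φ d) := by
    rw [hasSum_iff_tendsto_nat_of_nonneg fun n => sub_nonneg.2 (hmono (by linarith))]
    have hlim : Tendsto (fun n : ℕ => d + n * d) atTop atTop :=
      tendsto_atTop_add_const_left _ d hnd
    have := (htop.comp hlim).sub_const (Φ d)
    refine this.congr fun n => ?_
    have h := Finset.sum_range_sub (fun k : ℕ => Φ (d + k * d)) n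
    simp only [Nat.cast_zero, zero_mul, add_zero] at h
    rw [Function.comp_apply, ← h]
    refine Finset.sum_congr rfl fun k _ => ?_
    push_cast
    ring_nf
  simp_rw [h_integral] at h1
  have h4 := h1.unique (HasSum.of_nat_of_neg_add_one h2 h3)
  rw [h4]
  ring

/-- What remains are the terms with k < 0, evaluated to the right of t, where the weight is
exponentially small. -/
lemma tendsto_periodization_sub {τ : ℕ} (hτ : 2 ≤ τ) {d : ℝ} (hd : 0 < d) :
    Tendsto (fun t => periodization τ d t - ∑' n : ℕ, renewalWeight τ (t - n * d)) atTop
      (𝓝 0) := by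
  have hgeo : Summable fun n : ℕ => Real.exp (-(n * d)) := by
    have := Real.summable_exp_nat_mul_iff.2 (neg_lt_zero.2 hd)
    simpa using this
  have hs1 : ∀ t, Summable fun n : ℕ => renewalWeight τ (t - ((n : ℤ) : ℝ) * d) := fun t =>
    (summable_renewalWeight_int hτ hd t).comp_injective Nat.cast_injective
  have hs2 : ∀ t, Summable fun n : ℕ => renewalWeight τ (t - ((-((n : ℤ) + 1) : ℤ) : ℝ) * d) :=
    fun t => (summable_renewalWeight_int hτ hd t).comp_injective
      (i := fun n : ℕ => (-((n : ℤ) + 1) : ℤ)) fun a b h => by simpa using h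
  have he : ∀ t, periodization τ d t - ∑' n : ℕ, renewalWeight τ (t - n * d) =
      ∑' n : ℕ, renewalWeight τ (t - ((-((n : ℤ) + 1) : ℤ) : ℝ) * d) := by
    intro t
    have := (HasSum.of_nat_of_neg_add_one (f := fun k : ℤ => renewalWeight τ (t - k * d))
      (hs1 t).hasSum (hs2 t).hasSum).tsum_eq
    rw [periodization, this]
    simp
  simp_rw [he]
  refine squeeze_zero' (g := fun t => Real.exp 1 * ∑' n : ℕ, Real.exp (-(n * d)) * Real.exp (-t))
    (Eventually.of_forall fun t => tsum_nonneg fun n => renewalWeight_nonneg τ _) ?_ ?_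
  · filter_upwards [eventually_ge_atTop 0] with t ht
    rw [← tsum_mul_left]
    refine (hs2 t).tsum_le_tsum (fun n => ?_) ((hgeo.mul_right _).mul_left _)
    refine (renewalWeight_le hτ _).trans ?_
    rw [← Real.exp_add (-(n * d))]
    gcongr
    have : (0 : ℝ) ≤ n * d := by positivity
    push_cast
    rw [abs_of_nonneg (by nlinarith)]
    nlinarith
  · simp_rw [tsum_mul_right]
    have := (Real.tendsto_exp_neg_atTop_nhds_zero.const_mul
      (∑' n : ℕ, Real.exp (-(n * d)))).const_mul (Real.exp 1)
    simpa using this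

/-! ### The group generated by the logarithms of the probabilities -/

lemma log_letter_neg (hm : 2 ≤ m) (hp : ∀ j, 0 < p j) (hp1 : ∑ j, p j = 1) (j : Fin m) :
    Real.log (p j) < 0 := Real.log_neg (hp j) (letter_lt_one hm hp hp1 j)

lemma closure_range_neg_log :
    AddSubgroup.closure (Set.range fun j => -Real.log (p j)) =
      AddSubgroup.closure (Set.range fun j => Real.log (p j)) := by
  rw [← AddSubgroup.closure_neg]
  congr 1
  ext x
  simp [Set.mem_neg, neg_inj]

lemma IsPeriodic.exists_closure_eq (hm : 2 ≤ m) (hp : ∀ j, 0 < p j) (hp1 : ∑ j, p j = 1)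
    (h : IsPeriodic p) : ∃ d : ℝ, 0 < d ∧
      AddSubgroup.closure (Set.range fun j => Real.log (p j)) = AddSubgroup.zmultiples d := by
  let j₀ : Fin m := ⟨0, by omega⟩
  have hlog := log_letter_neg hm hp hp1
  choose q hq using fun j => h j j₀
  set N : ℕ := ∏ j, (q j).den with hN
  have hN0 : (N : ℝ) ≠ 0 := by
    rw [Nat.cast_ne_zero, hN, Finset.prod_ne_zero_iff]
    exact fun j _ => (q j).den_nz
  -- A common denominator of the ratios puts every logarithm in aℤ. A dense subgroup cannot lie in a
  -- cyclic one, so the generated group is itself cyclic.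
  set a := Real.log (p j₀) / N with ha
  have hle : AddSubgroup.closure (Set.range fun j => Real.log (p j)) ≤
      AddSubgroup.zmultiples a := by
    rw [AddSubgroup.closure_le]
    rintro _ ⟨j, rfl⟩
    obtain ⟨c, hc⟩ : (q j).den ∣ N := Finset.dvd_prod_of_mem _ (Finset.mem_univ j)
    rw [SetLike.mem_coe, AddSubgroup.mem_zmultiples_iff]
    refine ⟨(q j).num * c, ?_⟩
    have h1 : Real.log (p j) = q j * Real.log (p j₀) := by
      rw [← hq j, div_mul_cancel₀ _ (hlog j₀).ne]
    have h2 : ((q j : ℚ) : ℝ) * (q j).den = (q j).num := by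
      exact_mod_cast Rat.mul_den_eq_num (q j)
    have h3 : (N : ℝ) = (q j).den * c := by exact_mod_cast hc
    simp only [zsmul_eq_mul, Int.cast_mul, Int.cast_natCast]
    rw [h1, ← h2, ha, mul_div_assoc', div_eq_iff hN0, h3]
    ring
  obtain ⟨b, hb⟩ : ∃ b, AddSubgroup.closure (Set.range fun j => Real.log (p j)) =
      AddSubgroup.zmultiples b := by
    rcases (AddSubgroup.dense_xor_cyclic
      (AddSubgroup.closure (Set.range fun j => Real.log (p j)))).or with hd | hc
    · rcases AddSubgroup.dense_xor_cyclic (AddSubgroup.zmultiples a) with ⟨_, h2⟩ | ⟨_, h2⟩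
      · exact absurd ⟨a, rfl⟩ h2
      · exact absurd (hd.mono hle) h2
    · exact hc
  have hb0 : b ≠ 0 := by
    rintro rfl
    have : Real.log (p j₀) ∈ AddSubgroup.closure (Set.range fun j => Real.log (p j)) :=
      AddSubgroup.subset_closure ⟨j₀, rfl⟩
    rw [hb, AddSubgroup.zmultiples_zero_eq_bot, AddSubgroup.mem_bot] at this
    exact (hlog j₀).ne this
  refine ⟨|b|, abs_pos.2 hb0, ?_⟩
  rcases abs_choice b with h | h
  · rw [h, hb]
  · rw [h, hb, AddSubgroup.zmultiples_neg]

lemma dense_closure_of_not_isPeriodic (h : ¬ IsPeriodic p) :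
    Dense (AddSubgroup.closure (Set.range fun j => -Real.log (p j)) : Set ℝ) := by
  rw [closure_range_neg_log]
  rcases (AddSubgroup.dense_xor_cyclic
    (AddSubgroup.closure (Set.range fun j => Real.log (p j)))).or with hd | ⟨a, ha⟩
  · exact hd
  · refine absurd (fun j k => ?_) h
    have hmem : ∀ j, ∃ z : ℤ, (z : ℝ) * a = Real.log (p j) := by
      intro j
      have : Real.log (p j) ∈ AddSubgroup.closure (Set.range fun j => Real.log (p j)) :=
        AddSubgroup.subset_closure ⟨j, rfl⟩
      rw [ha, AddSubgroup.mem_zmultiples_iff] at this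
      simpa using this
    obtain ⟨x, hx⟩ := hmem j
    obtain ⟨y, hy⟩ := hmem k
    rw [← hx, ← hy]
    -- If the generator is zero, all logarithms vanish and the ratio 0/0 is 0 by convention.
    by_cases ha0 : a = 0
    · exact ⟨0, by simp [ha0]⟩
    · exact ⟨(x : ℚ) / y, by push_cast; rw [mul_div_mul_right _ _ ha0]⟩

/-! ### Asymptotics of the Poissonized mean -/

lemma entropy_eq_sum : entropy p = ∑ j, p j * -Real.log (p j) := by
  simp [entropy]

lemma entropy_pos (hm : 2 ≤ m) (hp : ∀ j, 0 < p j) (hp1 : ∑ j, p j = 1) : 0 < entropy p := by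
  rw [entropy_eq_sum]
  exact Finset.sum_pos (fun j _ => mul_pos (hp j) (neg_pos.2 (log_letter_neg hm hp hp1 j)))
    ⟨⟨0, by omega⟩, Finset.mem_univ _⟩

lemma tendsto_renewalMean_of_dense (hm : 2 ≤ m) (hp : ∀ j, 0 < p j) (hp1 : ∑ j, p j = 1) {τ : ℕ}
    (hτ : 2 ≤ τ) (hd : Dense (AddSubgroup.closure (Set.range fun j => -Real.log (p j)) : Set ℝ)) :
    Tendsto (renewalMean p τ) atTop (𝓝 (1 / ((τ : ℝ) * ((τ : ℝ) - 1) * entropy p))) := by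
  obtain ⟨Φ, hΦ, hbot, htop⟩ := exists_antiderivative_renewalWeight hτ
  obtain ⟨M, -, hM⟩ := exists_renewalMean_le hm hp hp1 hτ
  have hτ1 : (0 : ℝ) ≤ (τ : ℝ) - 1 := by
    have : (2 : ℝ) ≤ τ := by exact_mod_cast hτ
    linarith
  have := renewal_nonlattice hp hp1 (renewalMean_nonneg hp τ) (fun t => (hM t).1)
    (continuous_renewalMean hm hp hp1 hτ) (renewalMean_eq hm hp hp1 hτ)
    (tendsto_renewalWeight_atTop hτ) (tendsto_renewalMean_atBot hm hp hp1 hτ) hτ1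
    (renewalMean_add_le hm hp hp1 hτ) hd hΦ hbot htop
  rw [← entropy_eq_sum] at this
  have := this.div_const (entropy p)
  rw [div_div] at this
  exact this.congr fun t => mul_div_cancel_right₀ _ (entropy_pos hm hp hp1).ne'

lemma tendsto_renewalMean_sub_periodization (hm : 2 ≤ m) (hp : ∀ j, 0 < p j)
    (hp1 : ∑ j, p j = 1) {τ : ℕ} (hτ : 2 ≤ τ) {d : ℝ} (hd : 0 < d)
    (hcl : AddSubgroup.closure (Set.range fun j => Real.log (p j)) = AddSubgroup.zmultiples d) :
    Tendsto (fun t => renewalMean p τ t - d / entropy p * periodization τ d t) atTop (𝓝 0) := by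
  obtain ⟨M, -, hM⟩ := exists_renewalMean_le hm hp hp1 hτ
  have hN : ∀ j, ∃ N : ℕ, -Real.log (p j) = N * d := by
    intro j
    have : -Real.log (p j) ∈ AddSubgroup.closure (Set.range fun j => Real.log (p j)) :=
      neg_mem (AddSubgroup.subset_closure ⟨j, rfl⟩)
    rw [hcl, AddSubgroup.mem_zmultiples_iff] at this
    obtain ⟨z, hz⟩ := this
    rw [zsmul_eq_mul] at hz
    have hz0 : (0 : ℝ) < z := by
      by_contra hneg
      have := log_letter_neg hm hp hp1 j
      nlinarith
    obtain ⟨N, rfl⟩ := Int.eq_ofNat_of_zero_le (by exact_mod_cast hz0.le : 0 ≤ z)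
    exact ⟨N, by rw [← hz]; simp⟩
  choose N hN using hN
  have hmem : d ∈ AddSubgroup.closure (Set.range fun j => -Real.log (p j)) := by
    rw [closure_range_neg_log, hcl]
    exact AddSubgroup.mem_zmultiples d
  have hs : ∀ t, Summable fun n : ℕ => renewalWeight τ (t - n * d) := fun t => by
    simpa [Function.comp_def] using
      (summable_renewalWeight_int hτ hd t).comp_injective (Nat.cast_injective (R := ℤ))
  have h1 := renewal_lattice hp hp1
    (fun t => by rw [abs_of_nonneg (renewalMean_nonneg hp τ t)]; exact (hM t).1)
    (renewalMean_eq hm hp hp1 hτ) (tendsto_renewalWeight_atTop hτ)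
    (tendsto_renewalMean_atBot hm hp hp1 hτ) hd hN hmem hs
  rw [← entropy_eq_sum] at h1
  have h2 := (h1.sub ((tendsto_periodization_sub hτ hd).const_mul d)).div_const (entropy p)
  simp only [mul_zero, sub_zero, zero_div] at h2
  refine h2.congr fun t => ?_
  have := (entropy_pos hm hp hp1).ne'
  field_simp
  ring

/-- Transfer from the Poissonized mean to the mean number of occurrences. -/
lemma isLittleO_integral_fringeCount (hm : 2 ≤ m) (hp : ∀ j, 0 < p j) (hp1 : ∑ j, p j = 1)
    (T : Shape m) (hT : 2 ≤ T.size) {c : ℝ} {ξ : ℝ → ℝ}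
    (h : Tendsto (fun t => renewalMean p T.size t - (c + ξ (Real.exp t))) atTop (𝓝 0)) :
    (fun n : ℕ => (∫ ω, (fringeCount n T ω : ℝ) ∂(stringsLaw p)) -
      (shapeFunctional p T * c * n + shapeFunctional p T * ξ n * n)) =o[atTop]
        fun n : ℕ => (n : ℝ) := by
  rw [Asymptotics.isLittleO_iff_tendsto']
  · have hlog : Tendsto (fun n : ℕ => Real.log n) atTop atTop :=
      Real.tendsto_log_atTop.comp tendsto_natCast_atTop_atTop
    have := ((tendsto_binomial_sub_renewalMean hm hp hp1 hT).add (h.comp hlog)).const_mul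
      (shapeFunctional p T)
    rw [add_zero, mul_zero] at this
    refine this.congr' ?_
    filter_upwards [eventually_gt_atTop 0] with n hn
    have hn' : (0 : ℝ) < n := by exact_mod_cast hn
    rw [(integrable_fringeCount_and_integral_eq hp hp1 T n
      (summable_binomial hm hp hp1 hT n)).2, Function.comp_apply, Real.exp_log hn']
    field_simp
    ring
  · filter_upwards [eventually_gt_atTop 0] with n hn h0
    exact absurd h0 (by exact_mod_cast hn.ne')

end RandomTrie

end

/-! ### The main theorem -/

open RandomTrie

theorem proposition1 (m : ℕ) (hm : 2 ≤ m) (p : Fin m → ℝ) (hp : ∀ j, 0 < p j)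
    (hp1 : ∑ j, p j = 1) (T : RandomTrie.Shape m) (τ : ℕ) (hT : T.size = τ) (hτ : 2 ≤ τ) :
    (∀ n : ℕ, MeasureTheory.Integrable
      (fun ω => (RandomTrie.fringeCount n T ω : ℝ)) (RandomTrie.stringsLaw p)) ∧
    ∃ ξ : ℝ → ℝ,
      (RandomTrie.IsPeriodic p → ∃ d : ℝ, 0 < d ∧
        AddSubgroup.closure (Set.range fun j => Real.log (p j)) = AddSubgroup.zmultiples d ∧
        RandomTrie.IsFluctuation d ξ) ∧
      (¬ RandomTrie.IsPeriodic p → ∀ x, ξ x = 0) ∧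
      (fun n : ℕ =>
        (∫ ω, (RandomTrie.fringeCount n T ω : ℝ) ∂(RandomTrie.stringsLaw p)) -
          (RandomTrie.shapeFunctional p T / ((τ : ℝ) * ((τ : ℝ) - 1) * RandomTrie.entropy p) *
              (n : ℝ) + ξ n * (n : ℝ)))
        =o[Filter.atTop] fun n : ℕ => (n : ℝ) := by
  subst hT
  refine ⟨fun n => (integrable_fringeCount_and_integral_eq hp hp1 T n
    (summable_binomial hm hp hp1 hτ n)).1, ?_⟩
  set c : ℝ := 1 / ((T.size : ℝ) * ((T.size : ℝ) - 1) * entropy p) with hc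
  have hQ : shapeFunctional p T / ((T.size : ℝ) * ((T.size : ℝ) - 1) * entropy p) =
      shapeFunctional p T * c := by rw [hc, mul_one_div]
  rw [hQ]
  by_cases hper : IsPeriodic p
  · obtain ⟨d, hd, hcl⟩ := hper.exists_closure_eq hm hp hp1
    have hcont := continuous_periodization hτ hd
    -- Subtracting `c`, the mean of the periodic limit, makes the fluctuation average to zero.
    refine ⟨fun x => shapeFunctional p T *
      (d / entropy p * periodization T.size d (Real.log x) - c),
      fun _ => ⟨d, hd, hcl, ?_, ?_, ?_⟩, fun h => absurd hper h, ?_⟩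
    · have hlog : ContinuousOn Real.log (Set.Ioi 0) :=
        Real.continuousOn_log.mono fun x hx => (Set.mem_Ioi.1 hx).ne'
      exact continuousOn_const.mul ((continuousOn_const.mul
        (hcont.comp_continuousOn hlog)).sub continuousOn_const)
    · intro t
      simp only [Real.log_exp]
      rw [periodic_periodization T.size d t]
    · simp only [Real.log_exp]
      rw [intervalIntegral.integral_const_mul, intervalIntegral.integral_sub
        ((hcont.const_mul _).intervalIntegrable _ _) intervalIntegrable_const,
        intervalIntegral.integral_const_mul, integral_periodization hτ hd,
        intervalIntegral.integral_const, smul_eq_mul, hc, sub_zero, div_mul_div_comm, mul_one,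
        mul_one_div, mul_comm (entropy p), sub_self, mul_zero, mul_zero]
    · refine isLittleO_integral_fringeCount hm hp hp1 T hτ
        (ξ := fun x => d / entropy p * periodization T.size d (Real.log x) - c) ?_
      simpa using tendsto_renewalMean_sub_periodization hm hp hp1 hτ hd hcl
  · refine ⟨fun _ => 0, fun h => absurd h hper, fun _ _ => rfl, ?_⟩
    have h := tendsto_renewalMean_of_dense hm hp hp1 hτ (dense_closure_of_not_isPeriodic hper)
    rw [← hc] at h
    have := isLittleO_integral_fringeCount hm hp hp1 T hτ (c := c) (ξ := fun _ => 0)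
      (by simpa only [add_zero, sub_self] using h.sub_const c)
    simpa using this
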